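/- **Setting.** Let $\mathbb S^1=\mathbb R/\mathbb Z$ and let $f:\mathbb S^1\times\mathbb R\to\mathbb R$ be a smooth ($C^\infty$) function; $D_2^jf$ is its $j$-th partial derivative in the second variable. Let $F:B^1\to B^0$, $F(u)(t)=u'(t)+f(t,u(t))$, where either $B^1=C^1(\mathbb S^1)$ and $B^0=C^0(\mathbb S^1)$, or $B^1=H^1(\mathbb S^1)$ and $B^0=L^2(\mathbb S^1)$. The result holds in both cases. *Strata.* For a function $g$ on $\mathbb S^1$ write $\bar g=\int_{\mathbb S^1} g$ and $\tilde g=g-\bar g$. The map $\Psi:B^1\to B^0$, $\Psi(u)=\widetilde{F(u)}+\bar u$, is a diffeomorphism onto an open subset of $B^0$, and $F\circ\Psi^{-1}$ has the form $\tilde v+\bar u\mapsto\tilde v+\phi(\tilde v,\bar u)$ with $\phi$ real valued. For $k\ge1$ let $S_k$ be the set of $u\in B^1$ such that $D_2\phi=\dots=D_2^k\phi=0$ at the point $\Psi(u)$. *Morin singularities.* Let $G:Z_1\to Z_2$ be a smooth map between Banach spaces. A point $z_0$ is a Morin singularity of order $k\ge 1$ of $G$ if $DG(z_0)$ is a Fredholm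 operator of index $0$ with kernel of dimension $1$ and, after smooth changes of variables near $z_0$ and $G(z_0)$, the map $G$ is written as $X\times\mathbb R\to X\times\mathbb R$, $(x,y)\mapsto(x,\mu(x,y))$, with $X$ a Banach space, so that at the point corresponding to $z_0$: $D_2\mu=\dots=D_2^k\mu=0$, $D_2^{k+1}\mu\neq0$, and the derivative of $(D_2\mu,\dots,D_2^{k-1}\mu)$ is surjective onto $\mathbb R^{k-1}$. *Functionals.* For $u\in B^1$ let $\kappa(x)=x-\lfloor x\rfloor-\frac12$ and $w(t)=w_u(t)=\exp\left(-\int_0^1\kappa(s-t)\,D_2f(s,u(s))\,ds\right)$, and put $A(t)=\int_0^tD_2^2f(s,u(s))\,w(s)\,ds$. Define $$\begin{aligned} \Sigma_1(u)&=\int_0^1D_2f(t,u(t))\,dt,\\ \Sigma_2(u)&=\int_0^1D_2^2f(t,u(t))\,w(t)\,dt,\\ \Sigma_3(u)&=\int_0^1D_2^3f(t,u(t))\,w(t)^2\,dt,\\ \Sigma_4(u)&=\int_0^1\Big(D_2^4f(t,u(t))\,w(t)^3-2D_2^3f(t,u(t))\,w(t)^2A(t)\Big)dt,\\ \Sigma_5(u)&=\int_0^1\Big(D_2^5f(t,u(t))\,w(t)^4-5D_2^4f(t,u(t))\,w(t)^3A(t)+5D_2^3f(t,u(t))\,w(t)^2A(t)^2\Big)dt.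 \end{aligned}$$ **Proposition.** For $k=1,\dots,5$, $$S_k=\{u\in B^1:\ \Sigma_i(u)=0,\ i=1,\dots,k\}.$$ Furthermore, for $k=1,\dots,4$, a point $u\in B^1$ is a Morin singularity of order $k$ of $F$ if and only if (a) $\Sigma_i(u)=0$ for $i=1,\dots,k$; (b) $\Sigma_{k+1}(u)\neq0$; (c) the derivative at $u$ of the map $B^1\to\mathbb R^{k-1}$, $v\mapsto(\Sigma_1(v),\dots,\Sigma_{k-1}(v))$, is surjective. -/

import Mathlib

open MeasureTheory
open scoped ContDiff

noncomputable section

namespace CircleODE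

/-! ### Morin singularities of maps between Banach spaces -/

section Morin

universe u

variable {Z₁ Z₂ : Type u} [NormedAddCommGroup Z₁] [NormedSpace ℝ Z₁]
  [NormedAddCommGroup Z₂] [NormedSpace ℝ Z₂]

/-- Adapted coordinates for `G : Z₁ → Z₂` near `z₀`: smooth changes of variables `α` in the domain,
near `z₀`, and `β` in the image, near `G z₀`, in which `G` takes the form
`(x, y) ↦ (x, μ (x, y))` with `x` in a Banach space `X` and `y` real. -/
structure AdaptedCoordinates (G : Z₁ → Z₂) (z₀ : Z₁)
    (X : Type u) [NormedAddCommGroup X] [NormedSpace ℝ X] where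
  /-- the change of variables in the domain -/
  α : OpenPartialHomeomorph Z₁ (X × ℝ)
  /-- the change of variables in the image -/
  β : OpenPartialHomeomorph Z₂ (X × ℝ)
  mem_source : z₀ ∈ α.source
  mapsTo : Set.MapsTo G α.source β.source
  contDiffOn_α : ContDiffOn ℝ ∞ α α.source
  contDiffOn_α_symm : ContDiffOn ℝ ∞ α.symm α.target
  contDiffOn_β : ContDiffOn ℝ ∞ β β.source
  contDiffOn_β_symm : ContDiffOn ℝ ∞ β.symm β.target
  fst_eq : ∀ z ∈ α.source, (β (G z)).1 = (α z).1

/-- The last component `μ` of `G` in adapted coordinates, `β ∘ G ∘ α⁻¹ = (x, y) ↦ (x, μ (x, y))`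
(meaningful on the open set `α.target`). -/
def AdaptedCoordinates.μ {G : Z₁ → Z₂} {z₀ : Z₁}
    {X : Type u} [NormedAddCommGroup X] [NormedSpace ℝ X]
    (A : AdaptedCoordinates G z₀ X) (p : X × ℝ) : ℝ :=
  (A.β (G (A.α.symm p))).2

/-- The partial derivative `D₂ⁱ μ` of a function `μ : X × ℝ → ℝ` with respect to its last,
real, variable. -/
def dLast {X : Type u} (μ : X × ℝ → ℝ) (i : ℕ) (p : X × ℝ) : ℝ :=
  iteratedDeriv i (fun y : ℝ => μ (p.1, y)) p.2

/-- `z₀` is a Morin singularity of order `k` of the smooth map `G`: the derivative `DG(z₀)` is a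
Fredholm operator of index `0` with kernel of dimension `1` and, in adapted coordinates
`(x, y) ↦ (x, μ (x, y))`, at the point `p` which corresponds to `z₀`,
* `D₂ μ = ⋯ = D₂ᵏ μ = 0`,
* `D₂ᵏ⁺¹ μ ≠ 0`,
* the derivative of `(D₂ μ, …, D₂ᵏ⁻¹ μ)` is surjective. -/
def IsMorinSingularity (G : Z₁ → Z₂) (k : ℕ) (z₀ : Z₁) : Prop :=
  ContDiff ℝ ∞ G ∧
  (fderiv ℝ G z₀).IsFredholm ∧
  Module.finrank ℝ (fderiv ℝ G z₀).ker = 1 ∧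
  Module.finrank ℝ (Z₂ ⧸ (fderiv ℝ G z₀).range) = 1 ∧
  ∃ (X : Type u) (_ : NormedAddCommGroup X) (_ : NormedSpace ℝ X) (_ : CompleteSpace X)
    (A : AdaptedCoordinates G z₀ X),
    (∀ i, 1 ≤ i → i ≤ k → dLast A.μ i (A.α z₀) = 0) ∧
    dLast A.μ (k + 1) (A.α z₀) ≠ 0 ∧
    Function.Surjective
      (fderiv ℝ (fun (p : X × ℝ) (i : Fin (k - 1)) => dLast A.μ (i + 1) p) (A.α z₀))

end Morin

/-! ### Function spaces on the circle `𝕊¹ = ℝ / ℤ` -/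

/-- `C⁰(𝕊¹)`, with the sup norm. -/
abbrev C0 : Type := C(UnitAddCircle, ℝ)

/-- `L²(𝕊¹)`. -/
abbrev L2 : Type := Lp ℝ 2 (volume : Measure UnitAddCircle)

/-- `C¹(𝕊¹)` as the space of pairs `(u, u')` with `u'` the (continuous) derivative of `u`; the
norm is `max (sup |u|) (sup |u'|)`. -/
def C1 : Submodule ℝ (C0 × C0) where
  carrier := {p | ∀ t : ℝ, HasDerivAt (fun s : ℝ => p.1 (s : UnitAddCircle))
    (p.2 (t : UnitAddCircle)) t}
  add_mem' := fun hp hq t => (hp t).add (hq t)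
  zero_mem' := fun t => hasDerivAt_const t (0 : ℝ)
  smul_mem' := fun c _ hp t => (hp t).const_mul c

/-- Almost everywhere equality on the circle, read on the fundamental domain. -/
theorem ae_Ioc_of_ae {P : UnitAddCircle → Prop} (h : ∀ᵐ x, P x) :
    ∀ᵐ s : ℝ ∂(volume.restrict (Set.Ioc (0 : ℝ) 1)), P (s : UnitAddCircle) := by
  have h1 := UnitAddCircle.measurePreserving_mk 0
  rw [zero_add] at h1
  exact h1.quasiMeasurePreserving.ae h

theorem intervalIntegrable_L2 (v : L2) {t : ℝ} (ht : t ∈ Set.Icc (0 : ℝ) 1) :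
    IntervalIntegrable (fun s : ℝ => v (s : UnitAddCircle)) volume 0 t := by
  have h1 := UnitAddCircle.measurePreserving_mk 0
  rw [zero_add] at h1
  have h2 : Integrable (v : UnitAddCircle → ℝ) volume :=
    (Lp.memLp v).integrable (by norm_num)
  have h3 := h1.integrable_comp_of_integrable h2
  rw [intervalIntegrable_iff_integrableOn_Ioc_of_le ht.1]
  exact IntegrableOn.mono_set h3 (Set.Ioc_subset_Ioc_right ht.2)

theorem integral_L2_congr {v w : ℝ → ℝ} {t : ℝ} (ht : t ∈ Set.Icc (0 : ℝ) 1)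
    (h : ∀ᵐ s : ℝ ∂(volume.restrict (Set.Ioc (0 : ℝ) 1)), v s = w s) :
    ∫ s in (0 : ℝ)..t, v s = ∫ s in (0 : ℝ)..t, w s := by
  rw [intervalIntegral.integral_of_le ht.1, intervalIntegral.integral_of_le ht.1]
  exact integral_congr_ae (ae_restrict_of_ae_restrict_of_subset (Set.Ioc_subset_Ioc_right ht.2) h)

/-- `H¹(𝕊¹)`, the space of periodic absolutely continuous functions with derivative in `L²`, as the
space of pairs `(u, u')` where `u` is a continuous function on the circle, `u' ∈ L²(𝕊¹)` and `u` is
the integral of `u'`. The norm is `max (sup |u|) ‖u'‖_{L²}`; it is equivalent to the usual Hilbert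
norm `(‖u‖² + ‖u'‖²)^{1/2}`, so that smoothness, derivatives and changes of variables have the same
meaning for both. -/
def H1 : Submodule ℝ (C0 × L2) where
  carrier := {p | ∀ t ∈ Set.Icc (0 : ℝ) 1,
    p.1 (t : UnitAddCircle) = p.1 ((0 : ℝ) : UnitAddCircle) +
      ∫ s in (0 : ℝ)..t, p.2 (s : UnitAddCircle)}
  add_mem' := by
    rintro ⟨u, v⟩ ⟨u', v'⟩ hp hq t ht
    have h1 := hp t ht
    have h2 := hq t ht
    have h3 := integral_L2_congr ht (ae_Ioc_of_ae (Lp.coeFn_add v v'))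
    simp only [Pi.add_apply] at h3
    rw [intervalIntegral.integral_add (intervalIntegrable_L2 v ht)
      (intervalIntegrable_L2 v' ht)] at h3
    simp only [Prod.mk_add_mk, ContinuousMap.add_apply] at h1 h2 ⊢
    rw [h3, h1, h2]
    ring
  zero_mem' := by
    intro t ht
    have h3 := integral_L2_congr ht
      (ae_Ioc_of_ae (Lp.coeFn_zero ℝ 2 (volume : Measure UnitAddCircle)))
    simp only [Prod.fst_zero, Prod.snd_zero, ContinuousMap.zero_apply]
    rw [h3]
    simp
  smul_mem' := by
    rintro c ⟨u, v⟩ hp t ht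
    have h1 := hp t ht
    have h3 := integral_L2_congr ht (ae_Ioc_of_ae (Lp.coeFn_smul c v))
    simp only [Pi.smul_apply, smul_eq_mul] at h3
    rw [intervalIntegral.integral_const_mul] at h3
    simp only [Prod.smul_mk, ContinuousMap.smul_apply, smul_eq_mul] at h1 ⊢
    rw [h3, h1]
    ring

/-! ### The operator `F(u) = u' + f(t, u)` -/

/-- `f : 𝕊¹ × ℝ → ℝ` is smooth: its lift to `ℝ × ℝ` is `C^∞`. -/
def IsSmooth (f : UnitAddCircle → ℝ → ℝ) : Prop :=
  ContDiff ℝ ∞ (fun p : ℝ × ℝ => f (p.1 : UnitAddCircle) p.2)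

theorem IsSmooth.continuous {f : UnitAddCircle → ℝ → ℝ} (hf : IsSmooth f) :
    Continuous (fun p : UnitAddCircle × ℝ => f p.1 p.2) := by
  have hq : IsOpenQuotientMap (Prod.map ((↑) : ℝ → UnitAddCircle) (id : ℝ → ℝ)) :=
    QuotientAddGroup.isOpenQuotientMap_mk.prodMap IsOpenQuotientMap.id
  exact hq.continuous_comp_iff.1 (ContDiff.continuous hf)

/-- The function `t ↦ f(t, u(t))`. -/
def substitute (f : UnitAddCircle → ℝ → ℝ) (hf : IsSmooth f) (u : C0) : C0 where
  toFun t := f t (u t)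
  continuous_toFun := hf.continuous.comp (continuous_id.prodMk u.continuous)

/-- `F : C¹ → C⁰`, `F(u)(t) = u'(t) + f(t, u(t))`. -/
def opC (f : UnitAddCircle → ℝ → ℝ) (hf : IsSmooth f) (u : C1) : C0 :=
  u.1.2 + substitute f hf u.1.1

/-- `F : H¹ → L²`, `F(u)(t) = u'(t) + f(t, u(t))`. -/
def opH (f : UnitAddCircle → ℝ → ℝ) (hf : IsSmooth f) (u : H1) : L2 :=
  u.1.2 + ContinuousMap.toLp 2 volume ℝ (substitute f hf u.1.1)

/-! ### The strata `S_k` -/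

section Strata

variable {B₁ B₀ : Type} [NormedAddCommGroup B₁] [NormedSpace ℝ B₁]
  [NormedAddCommGroup B₀] [NormedSpace ℝ B₀]

/-- The map `Ψ(u) = ṽ + ū`, where `v = F(u)`, `ū` and `v̄` are the averages of `u` and `v`, and
`ṽ = v - v̄`. Here `avg₁`, `avg₀` are the averages on domain and image, and `one` is the constant
function `1`. -/
def Psi (F : B₁ → B₀) (avg₁ : B₁ → ℝ) (avg₀ : B₀ → ℝ) (one : B₀) (u : B₁) : B₀ :=
  (F u - avg₀ (F u) • one) + avg₁ u • one

/-- `φ`, the average of `F ∘ Ψ⁻¹`: in the coordinates given by `Ψ`, `F` is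
`ṽ + ū ↦ ṽ + φ(ṽ + ū)`. It is meaningful on the image of the injective map `Ψ`. -/
def phi (F : B₁ → B₀) (avg₁ : B₁ → ℝ) (avg₀ : B₀ → ℝ) (one : B₀) (v : B₀) : ℝ :=
  avg₀ (F (Function.invFun (Psi F avg₁ avg₀ one) v))

/-- `S_k`: the points `u` at which the partial derivatives `D₂ φ, …, D₂ᵏ φ` in the vertical
direction (that of the constant functions) vanish, in the coordinates given by `Ψ`. -/
def stratum (F : B₁ → B₀) (avg₁ : B₁ → ℝ) (avg₀ : B₀ → ℝ) (one : B₀) (k : ℕ) : Set B₁ :=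
  {u | ∀ i, 1 ≤ i → i ≤ k →
    iteratedDeriv i
      (fun a : ℝ => phi F avg₁ avg₀ one (Psi F avg₁ avg₀ one u + a • one)) 0 = 0}

end Strata

/-- `S_k` for `F : C¹ → C⁰`. -/
def stratumC (f : UnitAddCircle → ℝ → ℝ) (hf : IsSmooth f) (k : ℕ) : Set C1 :=
  stratum (opC f hf) (fun u => ∫ t, u.1.1 t) (fun v => ∫ t, v t) (1 : C0) k

/-- `S_k` for `F : H¹ → L²`. -/
def stratumH (f : UnitAddCircle → ℝ → ℝ) (hf : IsSmooth f) (k : ℕ) : Set H1 :=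
  stratum (opH f hf) (fun u => ∫ t, u.1.1 t) (fun v => ∫ t, v t)
    (ContinuousMap.toLp 2 volume ℝ (1 : C0)) k

/-! ### The functionals `Σ₁, …, Σ₅` -/

/-- `D₂ʲ f(t, u(t))`, as a function of `t ∈ ℝ`. -/
def D2 (f : UnitAddCircle → ℝ → ℝ) (j : ℕ) (u : C0) (t : ℝ) : ℝ :=
  iteratedDeriv j (f (t : UnitAddCircle)) (u (t : UnitAddCircle))

/-- The Green kernel `k(x) = x - ⌊x⌋ - 1/2`. -/
def green (x : ℝ) : ℝ := x - ⌊x⌋ - 1 / 2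

/-- `w(t) = exp (- ∫ k(s - t) D₂f(s, u(s)) ds)`. -/
def kerVec (f : UnitAddCircle → ℝ → ℝ) (u : C0) (t : ℝ) : ℝ :=
  Real.exp (-∫ s in (0 : ℝ)..1, green (s - t) * D2 f 1 u s)

/-- `∫₀ᵗ D₂²f(s, u(s)) w(s) ds`. -/
def primitiveW (f : UnitAddCircle → ℝ → ℝ) (u : C0) (t : ℝ) : ℝ :=
  ∫ s in (0 : ℝ)..t, D2 f 2 u s * kerVec f u s

/-- The functionals `Σ₁, …, Σ₅` (the value for other indices is never used). -/
def Sig (f : UnitAddCircle → ℝ → ℝ) : ℕ → C0 → ℝ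
  | 1, u => ∫ t in (0 : ℝ)..1, D2 f 1 u t
  | 2, u => ∫ t in (0 : ℝ)..1, D2 f 2 u t * kerVec f u t
  | 3, u => ∫ t in (0 : ℝ)..1, D2 f 3 u t * kerVec f u t ^ 2
  | 4, u => ∫ t in (0 : ℝ)..1,
      (D2 f 4 u t * kerVec f u t ^ 3
        - 2 * D2 f 3 u t * kerVec f u t ^ 2 * primitiveW f u t)
  | 5, u => ∫ t in (0 : ℝ)..1,
      (D2 f 5 u t * kerVec f u t ^ 4
        - 5 * D2 f 4 u t * kerVec f u t ^ 3 * primitiveW f u t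
        + 5 * D2 f 3 u t * kerVec f u t ^ 2 * primitiveW f u t ^ 2)
  | _, _ => 0

end CircleODE

end

/-! The function $w=$ `kerFun`, the exponential of minus the periodic primitive of
$D_2f(t,u)-\Sigma_1(u)$, is periodic and satisfies $w'+D_2f(t,u)w=\Sigma_1(u)w$. Lifted to a vector
field $\nu$ on $B^1$ (`kerField`), it gives $DF(u)\nu(u)=\Sigma_1(u)w(u)$ for every $u$, not only on
the critical set. Moreover $\nu$ never vanishes and, where $\Sigma_1=0$, $w$ is outside the range of
$DF(u)$ (`fderiv_op_ne`).

In adapted coordinates $(x,y)\mapsto(x,\mu)$ near a zero of $\Sigma_1$, this reads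
$b\,D_2\mu=r\,\Sigma_1$ with $b,r$ nonvanishing, and $\nu=b\,\partial_y$ modulo $\Sigma_1$. Write
$\sigma_0,\dots,\sigma_4$ for `sigma`. Differentiation along $\nu$ takes $D_2^i\mu$ to
$b\,D_2^{i+1}\mu$ modulo $\sigma_0$, and integration by parts shows that it takes $\sigma_j$ to
$\sigma_{j+1}$ modulo $(\sigma_0,\dots,\sigma_j)$. By induction $D_2^{i+1}\mu$ is a unit times
$\sigma_i$ modulo $(\sigma_0,\dots,\sigma_{i-1})$ (`TriangularAt.of_along`). This triangular
relation transfers vanishing one order at a time; at a common zero it relates the differentials by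
an invertible triangular matrix, so it transfers surjectivity. Where $\Sigma_1\neq0$, $DF$ is
injective and $D_2\mu\neq0$.

The comparison works in any adapted coordinates; existence of some comes from $\Psi$, which is
injective with bijective derivative by elementary facts on periodic solutions of $z'+gz=c$. In them
$\mu$ is $\phi$, which settles the strata (`iteratedDeriv_phi`). Since $DF-D\Psi$ has rank at most
one, the Fredholm conditions follow as well.

Finally, `kerVec` is a positive multiple of `kerFun`, and `primitiveW` differs from the same
multiple of `primW` by a multiple of $t\sigma_1$. So $\Sigma_{i+1}$ is a positive multiple of
$\sigma_i$, always for $i\le2$ and where $\sigma_1=0$ for $i=3,4$. Condition (c) involves at most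
$\Sigma_1,\Sigma_2,\Sigma_3$, where the identity holds everywhere and may be differentiated. -/

noncomputable section

namespace CircleODE

open Filter Topology

/-! ### Ideals of germs of smooth functions -/

section Germs

variable {Z : Type*} [NormedAddCommGroup Z] [NormedSpace ℝ Z]

/-- The derivative of `g` along the vector field `ν`. -/
def along (ν : Z → Z) (g : Z → ℝ) (z : Z) : ℝ := fderiv ℝ g z (ν z)

/-- The germ of `g` at `z₀` belongs to the ideal generated by `q 0, …, q (n - 1)` in the ring of
germs of smooth functions. -/
def InIdeal (z₀ : Z) (q : ℕ → Z → ℝ) (n : ℕ) (g : Z → ℝ) : Prop :=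
  ∃ c : ℕ → Z → ℝ, (∀ j, ContDiffAt ℝ ∞ (c j) z₀) ∧
    g =ᶠ[𝓝 z₀] fun z => ∑ j ∈ Finset.range n, c j z * q j z

variable {z₀ : Z} {q : ℕ → Z → ℝ} {n m : ℕ} {g h : Z → ℝ} {ν : Z → Z}

theorem eventually_differentiableAt (hg : ContDiffAt ℝ ∞ g z₀) :
    ∀ᶠ z in 𝓝 z₀, DifferentiableAt ℝ g z := by
  have h1 : ContDiffAt ℝ 1 g z₀ := hg.of_le (by exact_mod_cast le_top)
  filter_upwards [h1.eventually (by simp)] with z hz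
  exact hz.differentiableAt one_ne_zero

theorem contDiffAt_along (hg : ContDiffAt ℝ ∞ g z₀) (hν : ContDiffAt ℝ ∞ ν z₀) :
    ContDiffAt ℝ ∞ (along ν g) z₀ :=
  (hg.fderiv_right (m := ∞) (by simp)).clm_apply hν

theorem along_congr (hgh : g =ᶠ[𝓝 z₀] h) : along ν g =ᶠ[𝓝 z₀] along ν h := by
  filter_upwards [hgh.fderiv (𝕜 := ℝ)] with z hz
  simp only [along, hz]

theorem along_mul (hg : ContDiffAt ℝ ∞ g z₀) (hh : ContDiffAt ℝ ∞ h z₀) :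
    along ν (fun z => g z * h z) =ᶠ[𝓝 z₀]
      fun z => g z * along ν h z + along ν g z * h z := by
  filter_upwards [eventually_differentiableAt hg, eventually_differentiableAt hh] with z h1 h2
  simp only [along]
  rw [fderiv_fun_mul h1 h2]
  simp [mul_comm]

theorem along_add (hg : ContDiffAt ℝ ∞ g z₀) (hh : ContDiffAt ℝ ∞ h z₀) :
    along ν (fun z => g z + h z) =ᶠ[𝓝 z₀] fun z => along ν g z + along ν h z := by
  filter_upwards [eventually_differentiableAt hg, eventually_differentiableAt hh] with z h1 h2
  simp only [along]
  rw [fderiv_fun_add h1 h2]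
  simp

theorem along_sum {s : Finset ℕ} {G : ℕ → Z → ℝ} (hG : ∀ j ∈ s, ContDiffAt ℝ ∞ (G j) z₀) :
    along ν (fun z => ∑ j ∈ s, G j z) =ᶠ[𝓝 z₀] fun z => ∑ j ∈ s, along ν (G j) z := by
  have : ∀ᶠ z in 𝓝 z₀, ∀ j ∈ s, DifferentiableAt ℝ (G j) z :=
    (Finset.eventually_all s).2 fun j hj => eventually_differentiableAt (hG j hj)
  filter_upwards [this] with z hz
  simp only [along]
  rw [fderiv_fun_sum hz]
  simp

theorem InIdeal.congr (hg : InIdeal z₀ q n g) (hgh : h =ᶠ[𝓝 z₀] g) : InIdeal z₀ q n h := by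
  obtain ⟨c, hc, hs⟩ := hg
  exact ⟨c, hc, hgh.trans hs⟩

theorem InIdeal.zero : InIdeal z₀ q n (fun _ => 0) :=
  ⟨fun _ _ => 0, fun _ => contDiffAt_const, by simp [EventuallyEq.refl]⟩

theorem InIdeal.add (hg : InIdeal z₀ q n g) (hh : InIdeal z₀ q n h) :
    InIdeal z₀ q n (fun z => g z + h z) := by
  obtain ⟨c, hc, hs⟩ := hg
  obtain ⟨d, hd, ht⟩ := hh
  refine ⟨fun j z => c j z + d j z, fun j => (hc j).add (hd j), ?_⟩
  filter_upwards [hs, ht] with z h1 h2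
  simp only [h1, h2, add_mul, Finset.sum_add_distrib]

theorem InIdeal.mul (hg : InIdeal z₀ q n g) (hh : ContDiffAt ℝ ∞ h z₀) :
    InIdeal z₀ q n (fun z => h z * g z) := by
  obtain ⟨c, hc, hs⟩ := hg
  refine ⟨fun j z => h z * c j z, fun j => hh.mul (hc j), ?_⟩
  filter_upwards [hs] with z h1
  simp only [h1, mul_assoc, Finset.mul_sum]

theorem InIdeal.neg (hg : InIdeal z₀ q n g) : InIdeal z₀ q n (fun z => -g z) := by
  refine (hg.mul (h := fun _ => -1) contDiffAt_const).congr (Eventually.of_forall fun z => ?_)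
  simp

theorem InIdeal.sub (hg : InIdeal z₀ q n g) (hh : InIdeal z₀ q n h) :
    InIdeal z₀ q n (fun z => g z - h z) := by
  refine (hg.add hh.neg).congr (Eventually.of_forall fun z => ?_)
  simp [sub_eq_add_neg]

theorem InIdeal.mono (hg : InIdeal z₀ q n g) (hnm : n ≤ m) : InIdeal z₀ q m g := by
  obtain ⟨c, hc, hs⟩ := hg
  refine ⟨fun j z => if j < n then c j z else 0, fun j => ?_, ?_⟩
  · by_cases hj : j < n
    · simpa [hj] using hc j
    · simpa [hj] using contDiffAt_const
  · filter_upwards [hs] with z h1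
    rw [h1, ← Finset.sum_subset (Finset.range_mono hnm)]
    · exact Finset.sum_congr rfl fun j hj => by simp [Finset.mem_range.1 hj]
    · intro j _ hj
      simp [Finset.mem_range.not.1 hj]

theorem InIdeal.gen {j : ℕ} (hj : j < n) : InIdeal z₀ q n (q j) := by
  classical
  refine ⟨fun i _ => if i = j then 1 else 0, fun _ => contDiffAt_const,
    Eventually.of_forall fun z => ?_⟩
  simp [hj]

theorem InIdeal.sum {s : Finset ℕ} {G : ℕ → Z → ℝ} (hG : ∀ j ∈ s, InIdeal z₀ q n (G j)) :
    InIdeal z₀ q n (fun z => ∑ j ∈ s, G j z) := by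
  classical
  induction s using Finset.induction_on with
  | empty => simpa using InIdeal.zero
  | insert a s ha ih =>
    simp only [Finset.sum_insert ha]
    exact (hG a (by simp)).add (ih fun j hj => hG j (by simp [hj]))

theorem InIdeal.apply_eq_zero (hg : InIdeal z₀ q n g) (hq : ∀ j < n, q j z₀ = 0) : g z₀ = 0 := by
  obtain ⟨c, -, hs⟩ := hg
  rw [hs.eq_of_nhds]
  exact Finset.sum_eq_zero fun j hj => by rw [hq j (Finset.mem_range.1 hj), mul_zero]

/-- Leibniz: $\nu(cq_j)=c\,\nu q_j+(\nu c)q_j$, and $\nu q_j$ is $q_{j+1}$ modulo earlier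
generators, so a derivative costs only one more generator. -/
theorem InIdeal.along (hg : InIdeal z₀ q n g) (hq : ∀ j, ContDiffAt ℝ ∞ (q j) z₀)
    (hν : ContDiffAt ℝ ∞ ν z₀)
    (hνq : ∀ j < n, InIdeal z₀ q (j + 1) (fun z => along ν (q j) z - q (j + 1) z)) :
    InIdeal z₀ q (n + 1) (along ν g) := by
  obtain ⟨c, hc, hs⟩ := hg
  refine InIdeal.congr ?_ (along_congr hs)
  refine InIdeal.congr ?_ (along_sum fun j _ => (hc j).mul (hq j))
  refine InIdeal.sum fun j hj => ?_
  have hj' := Finset.mem_range.1 hj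
  refine InIdeal.congr ?_ (along_mul (hc j) (hq j))
  refine (InIdeal.mul ?_ (hc j)).add ((InIdeal.gen (by omega)).mul (contDiffAt_along (hc j) hν))
  refine (((hνq j hj').mono (by omega)).add (InIdeal.gen (j := j + 1) (by omega))).congr
    (Eventually.of_forall fun z => ?_)
  simp

/-! ### Triangular changes of generators -/

/-- Near `z₀`, `p` is a nonvanishing multiple of `q i` up to the ideal generated by
`q 0, …, q (i - 1)`. -/
def TriangularAt (z₀ : Z) (q : ℕ → Z → ℝ) (i : ℕ) (p : Z → ℝ) : Prop :=
  ∃ e : Z → ℝ, ContDiffAt ℝ ∞ e z₀ ∧ e z₀ ≠ 0 ∧ InIdeal z₀ q i (fun z => p z - e z * q i z)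

/-- Differentiate $p_i\equiv e\,q_i$ along $\nu$: the left side becomes $b\,p_{i+1}$ modulo $q_0$,
the right side $e\,q_{i+1}$ modulo $q_0,\dots,q_i$. Division by $b$ gives the next unit, $e/b$. -/
theorem TriangularAt.of_along {p : ℕ → Z → ℝ} {b : Z → ℝ} {N : ℕ}
    (hp : ∀ i, ContDiffAt ℝ ∞ (p i) z₀)
    (hq : ∀ j, ContDiffAt ℝ ∞ (q j) z₀) (hν : ContDiffAt ℝ ∞ ν z₀)
    (hb : ContDiffAt ℝ ∞ b z₀) (hb0 : b z₀ ≠ 0)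
    (h0 : TriangularAt z₀ q 0 (p 0))
    (hνp : ∀ i, InIdeal z₀ q 1 (fun z => along ν (p i) z - b z * p (i + 1) z))
    (hνq : ∀ j < N, InIdeal z₀ q (j + 1) (fun z => along ν (q j) z - q (j + 1) z))
    (i : ℕ) (hi : i ≤ N) : TriangularAt z₀ q i (p i) := by
  induction i with
  | zero => exact h0
  | succ i ih =>
    obtain ⟨e, he, he0, hr⟩ := ih (by omega)
    have hbinv : ContDiffAt ℝ ∞ (fun z => (b z)⁻¹) z₀ := hb.inv hb0
    refine ⟨fun z => (b z)⁻¹ * e z, hbinv.mul he, mul_ne_zero (inv_ne_zero hb0) he0, ?_⟩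
    have h1 := hr.along hq hν fun j hj => hνq j (by omega)
    have h2 := (hνq i (by omega)).mul he
    have h3 : InIdeal z₀ q (i + 1) (fun z => CircleODE.along ν e z * q i z) :=
      (InIdeal.gen (by omega)).mul (contDiffAt_along he hν)
    have h4 := (hνp i).mono (m := i + 1) (by omega)
    refine ((((h1.add h2).add h3).sub h4).mul hbinv).congr ?_
    have hsplit : p i =ᶠ[𝓝 z₀] fun z => (p i z - e z * q i z) + e z * q i z :=
      Eventually.of_forall fun z => by simp
    have hprod : ContDiffAt ℝ ∞ (fun z => e z * q i z) z₀ := he.mul (hq i)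
    have hdiff : ContDiffAt ℝ ∞ (fun z => p i z - e z * q i z) z₀ := (hp i).sub hprod
    filter_upwards [along_congr (ν := ν) hsplit, along_add (ν := ν) hdiff hprod,
      along_mul (ν := ν) he (hq i), hb.continuousAt.eventually_ne hb0] with z e1 e2 e3 e4
    rw [e1, e2, e3]
    field_simp
    ring

theorem TriangularAt.apply_eq {p : Z → ℝ} {i : ℕ} (h : TriangularAt z₀ q i p)
    (hq : ∀ j < i, q j z₀ = 0) : p z₀ = 0 ↔ q i z₀ = 0 := by
  obtain ⟨e, -, he0, hr⟩ := h
  have := hr.apply_eq_zero hq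
  rw [sub_eq_zero] at this
  rw [this]
  simp [he0]

theorem TriangularAt.forall_eq_zero_iff {p : ℕ → Z → ℝ} {k : ℕ}
    (h : ∀ i < k, TriangularAt z₀ q i (p i)) :
    (∀ i < k, p i z₀ = 0) ↔ ∀ i < k, q i z₀ = 0 := by
  constructor
  · intro hp i
    induction i using Nat.strong_induction_on with
    | _ i ih =>
      intro hi
      exact ((h i hi).apply_eq fun j hj => ih j hj (by omega)).1 (hp i hi)
  · intro hq i hi
    exact ((h i hi).apply_eq fun j hj => hq j (by omega)).2 (hq i hi)

/-- At a common zero of the $q_j$ the product rule kills the derivatives of the coefficients, so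
$dp$ is a combination of $dq_0,\dots,dq_i$ whose last coefficient is the value of the unit. -/
theorem TriangularAt.fderiv_eq {p : Z → ℝ} {i : ℕ} (h : TriangularAt z₀ q i p)
    (hqd : ∀ j, DifferentiableAt ℝ (q j) z₀) (hq : ∀ j ≤ i, q j z₀ = 0) :
    DifferentiableAt ℝ p z₀ ∧ ∃ c : ℕ → ℝ, c i ≠ 0 ∧
      ∀ v, fderiv ℝ p z₀ v = ∑ j ∈ Finset.range (i + 1), c j * fderiv ℝ (q j) z₀ v := by
  obtain ⟨e, he, he0, c, hc, hs⟩ := h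
  let C : ℕ → Z → ℝ := fun j => if j = i then e else c j
  have hC : ∀ j, DifferentiableAt ℝ (C j) z₀ := by
    intro j
    by_cases hj : j = i
    · simpa [C, hj] using he.differentiableAt (by simp)
    · simpa [C, hj] using (hc j).differentiableAt (by simp)
  have hp : p =ᶠ[𝓝 z₀] fun z => ∑ j ∈ Finset.range (i + 1), C j z * q j z := by
    filter_upwards [hs] with z hz
    rw [Finset.sum_range_succ]
    have : ∑ j ∈ Finset.range i, C j z * q j z = ∑ j ∈ Finset.range i, c j z * q j z :=
      Finset.sum_congr rfl fun j hj => by simp [C, (Finset.mem_range.1 hj).ne]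
    rw [this, ← hz]
    simp [C]
  have hd : HasFDerivAt (fun z => ∑ j ∈ Finset.range (i + 1), C j z * q j z)
      (∑ j ∈ Finset.range (i + 1), C j z₀ • fderiv ℝ (q j) z₀) z₀ := by
    refine HasFDerivAt.fun_sum fun j hj => ?_
    have := (hC j).hasFDerivAt.fun_mul (hqd j).hasFDerivAt
    rw [hq j (by have := Finset.mem_range.1 hj; omega), zero_smul, add_zero] at this
    exact this
  refine ⟨(hd.congr_of_eventuallyEq hp).differentiableAt, fun j => C j z₀, by simpa [C] using he0,
    fun v => ?_⟩
  rw [(hd.congr_of_eventuallyEq hp).fderiv]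
  simp

theorem TriangularAt.surjective_fderiv_iff {p : ℕ → Z → ℝ} {k : ℕ}
    (h : ∀ i < k, TriangularAt z₀ q i (p i))
    (hqd : ∀ j, DifferentiableAt ℝ (q j) z₀) (hq : ∀ j < k, q j z₀ = 0) :
    Function.Surjective (fderiv ℝ (fun z (i : Fin k) => p i z) z₀) ↔
      Function.Surjective (fderiv ℝ (fun z (i : Fin k) => q i z) z₀) := by
  classical
  have h' : ∀ i : Fin k, DifferentiableAt ℝ (p i) z₀ ∧ ∃ c : ℕ → ℝ, c i ≠ 0 ∧
      ∀ v, fderiv ℝ (p i) z₀ v = ∑ j ∈ Finset.range (i + 1), c j * fderiv ℝ (q j) z₀ v :=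
    fun i => (h i i.2).fderiv_eq hqd fun j hj => hq j (by omega)
  choose hpd c hc0 hc using h'
  -- The matrix carrying the $dq_j$ to the $dp_i$; its diagonal consists of the values of the units.
  let T : Matrix (Fin k) (Fin k) ℝ := fun i j => if j ≤ i then c i j else 0
  have hT : T.IsLowerTriangular := by
    intro i j hij
    have : ¬ j ≤ i := not_le.2 (by simpa using hij)
    simp [T, this]
  have hdet : IsUnit T.det := by
    rw [Matrix.det_of_isLowerTriangular T hT, isUnit_iff_ne_zero, Finset.prod_ne_zero_iff]
    intro i _
    simpa [T] using hc0 i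
  have hfact : ⇑(fderiv ℝ (fun z (i : Fin k) => p i z) z₀) =
      T.mulVec ∘ ⇑(fderiv ℝ (fun z (i : Fin k) => q i z) z₀) := by
    funext v i
    rw [fderiv_pi (fun i => hpd i), Function.comp_apply,
      fderiv_pi (fun i : Fin k => hqd i)]
    simp only [ContinuousLinearMap.coe_pi', Matrix.mulVec, dotProduct, hc]
    have e1 : ∑ j : Fin k, T i j * fderiv ℝ (q j) z₀ v =
        ∑ j ∈ Finset.range k, if j ≤ (i : ℕ) then c i j * fderiv ℝ (q j) z₀ v else 0 := by
      rw [Finset.sum_range]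
      refine Finset.sum_congr rfl fun j _ => ?_
      by_cases hji : j ≤ i
      · simp [T, hji]
      · have : ¬ (j : ℕ) ≤ (i : ℕ) := fun hle => hji hle
        simp [T, hji, this]
    rw [e1, ← Finset.sum_filter]
    refine Finset.sum_congr ?_ fun _ _ => rfl
    ext j
    simp only [Finset.mem_range, Finset.mem_filter]
    omega
  have hbij : Function.Bijective T.mulVec :=
    ⟨Matrix.mulVec_injective_iff_isUnit.2 ((Matrix.isUnit_iff_isUnit_det _).2 hdet),
      Matrix.mulVec_surjective_iff_isUnit.2 ((Matrix.isUnit_iff_isUnit_det _).2 hdet)⟩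
  rw [hfact, Function.Surjective.of_comp_iff' hbij]

end Germs

/-! ### Adapted coordinates and a vector field spanning the kernel -/

section Adapted

universe u

variable {Z₁ Z₂ X : Type u} [NormedAddCommGroup Z₁] [NormedSpace ℝ Z₁]
  [NormedAddCommGroup Z₂] [NormedSpace ℝ Z₂] [NormedAddCommGroup X] [NormedSpace ℝ X]

theorem fderiv_symm_comp_fderiv (e : OpenPartialHomeomorph Z₁ Z₂)
    (he : ContDiffOn ℝ ∞ e e.source) (hs : ContDiffOn ℝ ∞ e.symm e.target)
    {z : Z₁} (hz : z ∈ e.source) (v : Z₁) :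
    fderiv ℝ e.symm (e z) (fderiv ℝ e z v) = v := by
  have h1 : DifferentiableAt ℝ e z :=
    (he.contDiffAt (e.open_source.mem_nhds hz)).differentiableAt (by simp)
  have h2 : DifferentiableAt ℝ e.symm (e z) :=
    (hs.contDiffAt (e.open_target.mem_nhds (e.map_source hz))).differentiableAt (by simp)
  have h3 : (fun x => e.symm (e x)) =ᶠ[𝓝 z] id := e.eventually_left_inverse hz
  have h4 := h2.hasFDerivAt.comp z h1.hasFDerivAt
  have h5 := (hasFDerivAt_id (𝕜 := ℝ) z).congr_of_eventuallyEq h3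
  have := congrArg (fun L : Z₁ →L[ℝ] Z₁ => L v) (h4.unique h5)
  simpa using this

theorem fderiv_comp_fderiv_symm (e : OpenPartialHomeomorph Z₁ Z₂)
    (he : ContDiffOn ℝ ∞ e e.source) (hs : ContDiffOn ℝ ∞ e.symm e.target)
    {z : Z₁} (hz : z ∈ e.source) (v : Z₂) :
    fderiv ℝ e z (fderiv ℝ e.symm (e z) v) = v := by
  have := fderiv_symm_comp_fderiv e.symm hs he (e.map_source hz) v
  simpa [e.left_inv hz] using this

namespace AdaptedCoordinates

variable {G : Z₁ → Z₂} {z₀ : Z₁} (A : AdaptedCoordinates G z₀ X)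

theorem contDiffOn_μ (hG : ContDiff ℝ ∞ G) : ContDiffOn ℝ ∞ A.μ A.α.target := by
  refine contDiff_snd.comp_contDiffOn ?_
  refine A.contDiffOn_β.comp (hG.comp_contDiffOn A.contDiffOn_α_symm) fun p hp => ?_
  exact A.mapsTo (A.α.map_target hp)

theorem dLast_succ {μ : X × ℝ → ℝ} {i : ℕ} {p : X × ℝ}
    (h : DifferentiableAt ℝ (dLast μ i) p) :
    dLast μ (i + 1) p = fderiv ℝ (dLast μ i) p (0, 1) := by
  have h1 : HasDerivAt (fun y : ℝ => (p.1, y)) ((0 : X), (1 : ℝ)) p.2 :=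
    (hasDerivAt_const _ _).prodMk (hasDerivAt_id _)
  have h2 := (show HasFDerivAt (dLast μ i) (fderiv ℝ (dLast μ i) p) (p.1, p.2) from
    h.hasFDerivAt).comp_hasDerivAt p.2 h1
  rw [← h2.deriv]
  simp only [dLast, iteratedDeriv_succ]
  rfl

theorem contDiffOn_dLast {μ : X × ℝ → ℝ} {s : Set (X × ℝ)} (hs : IsOpen s)
    (hμ : ContDiffOn ℝ ∞ μ s) (i : ℕ) : ContDiffOn ℝ ∞ (dLast μ i) s := by
  induction i with
  | zero =>
    refine hμ.congr fun p _ => ?_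
    simp [dLast]
  | succ i ih =>
    have h : ContDiffOn ℝ ∞ (fun p => fderiv ℝ (dLast μ i) p (0, 1)) s :=
      (ih.fderiv_of_isOpen hs (by simp)).clm_apply contDiffOn_const
    refine h.congr fun p hp => dLast_succ ?_
    exact (ih.contDiffAt (hs.mem_nhds hp)).differentiableAt (by simp)

theorem contDiffAt_dLast (hG : ContDiff ℝ ∞ G) (i : ℕ) {z : Z₁} (hz : z ∈ A.α.source) :
    ContDiffAt ℝ ∞ (dLast A.μ i) (A.α z) :=
  (contDiffOn_dLast A.α.open_target (A.contDiffOn_μ hG) i).contDiffAt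
    (A.α.open_target.mem_nhds (A.α.map_source hz))

theorem contDiffAt_α {z : Z₁} (hz : z ∈ A.α.source) : ContDiffAt ℝ ∞ A.α z :=
  A.contDiffOn_α.contDiffAt (A.α.open_source.mem_nhds hz)

theorem contDiffAt_β {z : Z₁} (hz : z ∈ A.α.source) : ContDiffAt ℝ ∞ A.β (G z) :=
  A.contDiffOn_β.contDiffAt (A.β.open_source.mem_nhds (A.mapsTo hz))

/-- The chain rule for $\beta\circ G=(\alpha_1,\mu\circ\alpha)$; here `dLast A.μ 0` is $\mu$ itself.
-/
theorem fderiv_μ_eq (hG : ContDiff ℝ ∞ G) {z : Z₁} (hz : z ∈ A.α.source) (v : Z₁) :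
    fderiv ℝ A.β (G z) (fderiv ℝ G z v) =
      ((fderiv ℝ A.α z v).1, fderiv ℝ (dLast A.μ 0) (A.α z) (fderiv ℝ A.α z v)) := by
  have hα := ((A.contDiffAt_α hz).differentiableAt (by simp)).hasFDerivAt
  have hβ := ((A.contDiffAt_β hz).differentiableAt (by simp)).hasFDerivAt
  have hμ := ((A.contDiffAt_dLast hG 0 hz).differentiableAt (by simp)).hasFDerivAt
  have hGd := (hG.contDiffAt (x := z)).differentiableAt (by simp) |>.hasFDerivAt
  have h1 := hβ.comp z hGd
  have h2 := hα.fst.prodMk (hμ.comp z hα)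
  have h3 : (A.β ∘ G) =ᶠ[𝓝 z] fun z => ((A.α z).1, (dLast A.μ 0 ∘ A.α) z) := by
    filter_upwards [A.α.open_source.mem_nhds hz] with y hy
    refine Prod.ext (A.fst_eq y hy) ?_
    simp [dLast, AdaptedCoordinates.μ, A.α.left_inv hy]
  have := congrArg (fun L : Z₁ →L[ℝ] X × ℝ => L v) (h1.unique (h2.congr_of_eventuallyEq h3))
  simpa using this

theorem dLast_one_eq (hG : ContDiff ℝ ∞ G) {z : Z₁} (hz : z ∈ A.α.source) :
    dLast A.μ 1 (A.α z) = fderiv ℝ (dLast A.μ 0) (A.α z) (0, 1) :=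
  dLast_succ ((A.contDiffAt_dLast hG 0 hz).differentiableAt (by simp))

/-- At a point where `DG` is injective, `D₂ μ` does not vanish. -/
theorem dLast_one_ne_zero (hG : ContDiff ℝ ∞ G)
    (hinj : Function.Injective (fderiv ℝ G z₀)) : dLast A.μ 1 (A.α z₀) ≠ 0 := by
  intro h0
  have hz := A.mem_source
  rw [A.dLast_one_eq hG hz] at h0
  -- If $D_2\mu=0$, the vertical vector pulled back by $\alpha$ is a nonzero element of the kernel
  -- of $DG(z_0)$.
  set v := fderiv ℝ A.α.symm (A.α z₀) (0, 1) with hv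
  have h1 : fderiv ℝ A.α z₀ v = (0, 1) :=
    fderiv_comp_fderiv_symm A.α A.contDiffOn_α A.contDiffOn_α_symm hz _
  have h2 := A.fderiv_μ_eq hG hz v
  rw [h1, h0] at h2
  have h3 := fderiv_symm_comp_fderiv A.β A.contDiffOn_β A.contDiffOn_β_symm (A.mapsTo hz)
    (fderiv ℝ G z₀ v)
  rw [h2] at h3
  have h4 : v = 0 := hinj (by rw [← h3, map_zero, ← Prod.zero_eq_mk, map_zero])
  rw [h4, map_zero] at h1
  simpa using congrArg Prod.snd h1

/-- Let `DG(z) ν(z) = δ(z) n(z)` with `ν(z₀) ≠ 0` and `n(z₀)` outside of the range of `DG(z₀)`.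
If the `q j` generate the same chain of ideals as the iterated derivatives of `q 0 = δ` along `ν`,
then so do the derivatives `D₂ʲ⁺¹ μ` of the last component of `G` in adapted coordinates. -/
theorem triangularAt_dLast (hG : ContDiff ℝ ∞ G) {ν : Z₁ → Z₁} {n : Z₁ → Z₂} {q : ℕ → Z₁ → ℝ}
    (hν : ContDiff ℝ ∞ ν) (hn : ContDiff ℝ ∞ n) (hq : ∀ j, ContDiff ℝ ∞ (q j))
    (h : ∀ z, fderiv ℝ G z (ν z) = q 0 z • n z) (hν0 : ν z₀ ≠ 0)
    (hn0 : ∀ v, fderiv ℝ G z₀ v ≠ n z₀) (hq0 : q 0 z₀ = 0) {N : ℕ}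
    (hνq : ∀ j < N, InIdeal z₀ q (j + 1) (fun z => along ν (q j) z - q (j + 1) z))
    (i : ℕ) (hi : i ≤ N) :
    TriangularAt z₀ q i (fun z => dLast A.μ (i + 1) (A.α z)) := by
  have hz := A.mem_source
  have hαs : ContDiffAt ℝ ∞ A.α z₀ := A.contDiffAt_α hz
  have hμs : ∀ j, ContDiffAt ℝ ∞ (fun z => dLast A.μ j (A.α z)) z₀ := fun j =>
    (A.contDiffAt_dLast hG j hz).comp z₀ hαs
  have hdμs : ∀ j, ContDiffAt ℝ ∞ (fun z => fderiv ℝ (dLast A.μ j) (A.α z)) z₀ := fun j =>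
    ((A.contDiffAt_dLast hG j hz).fderiv_right (m := ∞) (by simp)).comp z₀ hαs
  let b : Z₁ → ℝ := fun z => (fderiv ℝ A.α z (ν z)).2
  let nβ : Z₁ → X × ℝ := fun z => fderiv ℝ A.β (G z) (n z)
  have hb : ContDiffAt ℝ ∞ b z₀ :=
    ((hαs.fderiv_right (m := ∞) (by simp)).clm_apply hν.contDiffAt).snd
  have hnβ : ContDiffAt ℝ ∞ nβ z₀ :=
    (((A.contDiffAt_β hz).fderiv_right (m := ∞) (by simp)).comp z₀ hG.contDiffAt).clm_apply
      hn.contDiffAt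
  -- The two components of $DG\,\nu=q_0n$ in coordinates: the first says that $\nu$ is vertical up
  -- to a multiple of $q_0$, the second then compares $D_2\mu$ with $q_0$.
  have hkey : ∀ z ∈ A.α.source, fderiv ℝ A.α z (ν z) = q 0 z • ((nβ z).1, (0 : ℝ)) + b z • (0, 1)
      ∧ b z * dLast A.μ 1 (A.α z) =
        q 0 z * ((nβ z).2 - fderiv ℝ (dLast A.μ 0) (A.α z) ((nβ z).1, 0)) := by
    intro z hz
    have h1 := A.fderiv_μ_eq hG hz (ν z)
    rw [h, map_smul] at h1
    have h2 : fderiv ℝ A.α z (ν z) = q 0 z • ((nβ z).1, (0 : ℝ)) + b z • (0, 1) := by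
      refine Prod.ext ?_ ?_
      · simpa using (congrArg Prod.fst h1).symm
      · simp [b]
    refine ⟨h2, ?_⟩
    have h3 := congrArg Prod.snd h1
    simp only [Prod.smul_snd] at h3
    rw [h2, map_add, map_smul, map_smul, ← A.dLast_one_eq hG hz] at h3
    simp only [smul_eq_mul] at h3
    have h4 : q 0 z * (nβ z).2 = q 0 z * fderiv ℝ (dLast A.μ 0) (A.α z) ((nβ z).1, 0) +
      b z * dLast A.μ 1 (A.α z) := h3
    linarith
  -- At $z_0$, where $q_0=0$, $\nu$ is exactly $b\,\partial_y$; it is not zero.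
  have hb0 : b z₀ ≠ 0 := by
    intro h0
    have h1 := (hkey z₀ hz).1
    rw [hq0, h0, zero_smul, zero_smul, add_zero] at h1
    have h2 := fderiv_symm_comp_fderiv A.α A.contDiffOn_α A.contDiffOn_α_symm hz (ν z₀)
    rw [h1, map_zero] at h2
    exact hν0 h2.symm
  let r : Z₁ → ℝ := fun z => (nβ z).2 - fderiv ℝ (dLast A.μ 0) (A.α z) ((nβ z).1, 0)
  have hr : ContDiffAt ℝ ∞ r z₀ :=
    hnβ.snd.sub ((hdμs 0).clm_apply (hnβ.fst.prodMk contDiffAt_const))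
  -- If $r(z_0)=0$, then $n(z_0)$ reads $(x,D\mu(x,0))$ in the image, which is the value of
  -- $DG(z_0)$ on the vector $(x,0)$ of the domain.
  have hr0 : r z₀ ≠ 0 := by
    intro h0
    have h1 : dLast A.μ 1 (A.α z₀) = 0 := by
      have := (hkey z₀ hz).2
      rw [hq0, zero_mul] at this
      exact (mul_eq_zero.1 this).resolve_left hb0
    set v := fderiv ℝ A.α.symm (A.α z₀) ((nβ z₀).1, 0) with hv
    have h2 : fderiv ℝ A.α z₀ v = ((nβ z₀).1, 0) :=
      fderiv_comp_fderiv_symm A.α A.contDiffOn_α A.contDiffOn_α_symm hz _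
    have h3 := A.fderiv_μ_eq hG hz v
    rw [h2, ← sub_eq_zero.1 h0] at h3
    have h4 := fderiv_symm_comp_fderiv A.β A.contDiffOn_β A.contDiffOn_β_symm (A.mapsTo hz)
      (fderiv ℝ G z₀ v)
    rw [h3] at h4
    have h5 := fderiv_symm_comp_fderiv A.β A.contDiffOn_β A.contDiffOn_β_symm (A.mapsTo hz)
      (n z₀)
    exact hn0 v (h4.symm.trans h5)
  refine TriangularAt.of_along (p := fun i z => dLast A.μ (i + 1) (A.α z)) (ν := ν) (b := b)
    (fun i => hμs (i + 1)) (fun j => (hq j).contDiffAt) hν.contDiffAt hb hb0 ?_ ?_ hνq i hi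
  · refine ⟨fun z => (b z)⁻¹ * r z, (hb.inv hb0).mul hr,
      mul_ne_zero (inv_ne_zero hb0) hr0, ?_⟩
    refine InIdeal.zero.congr ?_
    filter_upwards [A.α.open_source.mem_nhds hz, hb.continuousAt.eventually_ne hb0] with z h1 h2
    have := (hkey z h1).2
    field_simp
    simp only [r]
    linarith
  -- The vertical part of $\nu$ produces $b\,D_2^{i+2}\mu$; the rest of $\nu$ carries a factor
  -- $q_0$.
  · intro i
    have hc : ContDiffAt ℝ ∞
        (fun z => fderiv ℝ (dLast A.μ (i + 1)) (A.α z) ((nβ z).1, 0)) z₀ :=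
      (hdμs (i + 1)).clm_apply (hnβ.fst.prodMk contDiffAt_const)
    refine ((InIdeal.gen (q := q) (j := 0) (n := 1) (by omega)).mul hc).congr ?_
    filter_upwards [A.α.open_source.mem_nhds hz] with z h1
    have h2 := ((A.contDiffAt_dLast hG (i + 1) h1).differentiableAt (by simp)).hasFDerivAt.comp z
      ((A.contDiffAt_α h1).differentiableAt (by simp)).hasFDerivAt
    have h3 : fderiv ℝ (fun z => dLast A.μ (i + 1) (A.α z)) z =
      (fderiv ℝ (dLast A.μ (i + 1)) (A.α z)).comp (fderiv ℝ A.α z) := h2.fderiv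
    simp only [along, h3, ContinuousLinearMap.comp_apply]
    rw [(hkey z h1).1, map_add, map_smul, map_smul,
      dLast_succ ((A.contDiffAt_dLast hG (i + 1) h1).differentiableAt (by simp))]
    simp only [smul_eq_mul]
    ring

/-- Pulling back by $\alpha$ composes the differential with $D\alpha(z_0)$, which is onto. -/
theorem surjective_fderiv_dLast_iff (hG : ContDiff ℝ ∞ G) (k : ℕ) :
    Function.Surjective
        (fderiv ℝ (fun (p : X × ℝ) (i : Fin k) => dLast A.μ (i + 1) p) (A.α z₀)) ↔
      Function.Surjective
        (fderiv ℝ (fun z (i : Fin k) => dLast A.μ (i + 1) (A.α z)) z₀) := by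
  have hz := A.mem_source
  have h1 : DifferentiableAt ℝ (fun (p : X × ℝ) (i : Fin k) => dLast A.μ (i + 1) p) (A.α z₀) :=
    differentiableAt_pi.2 fun i =>
      (A.contDiffAt_dLast hG (i + 1) hz).differentiableAt (by simp)
  have h2 := h1.hasFDerivAt.comp z₀
    ((A.contDiffAt_α hz).differentiableAt (by simp)).hasFDerivAt
  have h3 : fderiv ℝ (fun z (i : Fin k) => dLast A.μ (i + 1) (A.α z)) z₀ = _ := h2.fderiv
  rw [h3, ContinuousLinearMap.coe_comp]
  refine (Function.Surjective.of_comp_iff _ fun v => ?_).symm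
  exact ⟨_, fderiv_comp_fderiv_symm A.α A.contDiffOn_α A.contDiffOn_α_symm hz v⟩

end AdaptedCoordinates

end Adapted

/-! ### Rank one perturbations of isomorphisms -/

section Fredholm

variable {E F : Type*} [NormedAddCommGroup E] [NormedSpace ℝ E]
  [NormedAddCommGroup F] [NormedSpace ℝ F]

-- $T^{-1}$ inverts $L$ up to operators of finite rank, since $L-T$ factors through $\mathbb R$.
open scoped LinearMap.FiniteRangeSetoid in
theorem isFredholm_of_rank_one_perturbation (T : E ≃L[ℝ] F) (a : E →L[ℝ] ℝ) (b : F)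
    (L : E →L[ℝ] F) (hL : ∀ h, L h = T h + a h • b) : L.IsFredholm := by
  refine ContinuousLinearMap.IsFredholm.of_isQuasiInverse (v := (T.symm : F →L[ℝ] E)) ?_
  refine LinearMap.IsQuasiInverse.congr (T.toLinearEquiv.isQuasiInverse)
    (Setoid.refl _) (LinearMap.FiniteRangeSetoid.equiv_iff_hasNoetherianRange.2 ?_)
  have : (L : E →ₗ[ℝ] F) - (T.toLinearEquiv : E →ₗ[ℝ] F) =
      (LinearMap.toSpanSingleton ℝ F b).comp (a : E →ₗ[ℝ] ℝ) := by
    ext h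
    change L h - T h = a h • b
    rw [hL]
    simp
  rw [this]
  have hb : (LinearMap.toSpanSingleton ℝ F b).HasNoetherianRange := .of_isNoetherian_dom
  exact hb.comp_right _

/-- On the kernel $h=-a(h)T^{-1}b$, so the kernel is at most a line. A nonzero element forces
$a(T^{-1}b)=-1$, and then the range of $L$ is the hyperplane $a\circ T^{-1}=0$. -/
theorem finrank_of_rank_one_perturbation (T : E ≃L[ℝ] F) (a : E →L[ℝ] ℝ) (b : F)
    (L : E →L[ℝ] F) (hL : ∀ h, L h = T h + a h • b) {h₀ : E} (hne : h₀ ≠ 0) (h0 : L h₀ = 0) :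
    Module.finrank ℝ L.ker = 1 ∧ Module.finrank ℝ (F ⧸ L.range) = 1 := by
  have hT : ∀ h, L h = 0 → h = -a h • T.symm b := by
    intro h hh
    apply T.injective
    rw [hL] at hh
    rw [map_smul, T.apply_symm_apply, neg_smul]
    exact eq_neg_of_add_eq_zero_left hh
  have ha0 : a h₀ ≠ 0 := by
    intro h
    apply hne
    rw [hT h₀ h0, h]
    simp
  have hab : a (T.symm b) = -1 := by
    have h1 := congrArg a (hT h₀ h0)
    simp only [map_smul, smul_eq_mul] at h1
    have : a h₀ * (a (T.symm b) + 1) = 0 := by linarith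
    rcases mul_eq_zero.1 this with h | h
    · exact absurd h ha0
    · linarith
  constructor
  · refine finrank_eq_one_iff'.2 ⟨⟨h₀, h0⟩, fun h => hne (congrArg Subtype.val h), ?_⟩
    rintro ⟨h, hh⟩
    refine ⟨a h / a h₀, Subtype.ext ?_⟩
    change (a h / a h₀) • h₀ = h
    have e0 : (a h / a h₀) • h₀ = (a h / a h₀) • (-a h₀ • T.symm b) := by rw [← hT h₀ h0]
    rw [e0, smul_smul, div_mul_eq_mul_div, mul_neg, neg_div, mul_div_cancel_right₀ _ ha0,
      ← hT h hh]
  · have hr : L.range = ((a.comp (T.symm : F →L[ℝ] E) : F →L[ℝ] ℝ) : F →ₗ[ℝ] ℝ).ker := by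
      ext v
      constructor
      · rintro ⟨h, rfl⟩
        change a (T.symm (L h)) = 0
        rw [hL, map_add, map_smul, T.symm_apply_apply, map_add, map_smul, hab]
        simp
      · intro hv
        have hv' : a (T.symm v) = 0 := hv
        refine ⟨T.symm v, ?_⟩
        change L (T.symm v) = v
        rw [hL, hv']
        simp
    rw [hr]
    have hs : Function.Surjective ((a.comp (T.symm : F →L[ℝ] E) : F →L[ℝ] ℝ) : F →ₗ[ℝ] ℝ) := by
      intro c
      refine ⟨-c • b, ?_⟩
      change a (T.symm (-c • b)) = c
      rw [map_smul, map_smul, hab]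
      simp
    rw [(LinearMap.quotKerEquivOfSurjective _ hs).finrank_eq]
    simp

end Fredholm

/-! ### Calculus in `C⁰(𝕊¹)` -/

section Calculus

theorem continuous_coe (x : C0) : Continuous fun t : ℝ => x (t : UnitAddCircle) :=
  x.continuous.comp (AddCircle.continuous_mk' 1)

theorem periodic_coe (x : C0) : Function.Periodic (fun t : ℝ => x (t : UnitAddCircle)) 1 :=
  fun t => by simp

theorem C0.ext_real {x y : C0} (h : ∀ t : ℝ, x (t : UnitAddCircle) = y (t : UnitAddCircle)) :
    x = y :=
  ContinuousMap.ext fun t => QuotientAddGroup.induction_on t h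

/-- The function on the circle with a given continuous `1`-periodic lift. -/
def periodicLift (h : ℝ → ℝ) (hc : Continuous h) (hp : Function.Periodic h 1) : C0 where
  toFun := hp.lift
  continuous_toFun := (QuotientAddGroup.isOpenQuotientMap_mk.isQuotientMap).continuous_iff.2 hc

@[simp]
theorem periodicLift_coe (h : ℝ → ℝ) (hc : Continuous h) (hp : Function.Periodic h 1) (t : ℝ) :
    periodicLift h hc hp (t : UnitAddCircle) = h t := rfl

theorem integral_circle_eq (x : UnitAddCircle → ℝ) :
    ∫ t, x t = ∫ t in (0 : ℝ)..1, x (t : UnitAddCircle) := by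
  have := UnitAddCircle.intervalIntegral_preimage 0 x
  rw [zero_add] at this
  exact this.symm

/-- The average of a continuous function on the circle. -/
def mean : C0 →L[ℝ] ℝ :=
  LinearMap.mkContinuous
    { toFun := fun x => ∫ t, x t
      map_add' := fun x y => integral_add (x.continuous.integrable_of_hasCompactSupport
        (HasCompactSupport.of_compactSpace _)) (y.continuous.integrable_of_hasCompactSupport
        (HasCompactSupport.of_compactSpace _))
      map_smul' := fun c x => integral_const_mul c _ } 1 fun x => by
    have := norm_integral_le_of_norm_le_const (μ := (volume : Measure UnitAddCircle)) (f := x)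
      (C := ‖x‖) (Eventually.of_forall fun t => x.norm_coe_le_norm t)
    simpa [Measure.real] using this

theorem mean_eq (x : C0) : mean x = ∫ t in (0 : ℝ)..1, x (t : UnitAddCircle) :=
  integral_circle_eq x

theorem mean_one : mean 1 = 1 := by
  simp [mean_eq]

theorem intervalIntegrable_coe (x : C0) (a b : ℝ) :
    IntervalIntegrable (fun t : ℝ => x (t : UnitAddCircle)) volume a b :=
  (continuous_coe x).intervalIntegrable a b

theorem hasDerivAt_primitive (x : C0) (t : ℝ) :
    HasDerivAt (fun t : ℝ => ∫ s in (0 : ℝ)..t, x (s : UnitAddCircle)) (x (t : UnitAddCircle)) t :=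
  (continuous_coe x).integral_hasStrictDerivAt 0 t |>.hasDerivAt

theorem periodic_primitive (x : C0) : Function.Periodic
    (fun t : ℝ => (∫ s in (0 : ℝ)..t, x (s : UnitAddCircle)) - t * mean x) 1 := by
  intro t
  have h1 := (periodic_coe x).intervalIntegral_add_eq_add 0 t
    (fun a b => intervalIntegrable_coe x a b)
  simp only [zero_add] at h1
  simp only [h1, ← mean_eq]
  ring

/-- The periodic primitive `t ↦ ∫₀ᵗ (x - x̄)`. -/
def prim (x : C0) : C0 :=
  periodicLift (fun t : ℝ => (∫ s in (0 : ℝ)..t, x (s : UnitAddCircle)) - t * mean x)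
    ((continuous_iff_continuousAt.2 fun t => (hasDerivAt_primitive x t).continuousAt).sub
      (continuous_id.mul continuous_const)) (periodic_primitive x)

theorem prim_coe (x : C0) (t : ℝ) : prim x (t : UnitAddCircle) =
    (∫ s in (0 : ℝ)..t, x (s : UnitAddCircle)) - t * mean x := rfl

/-- `prim` as a continuous linear map. -/
def primL : C0 →L[ℝ] C0 :=
  LinearMap.mkContinuous
    { toFun := prim
      map_add' := fun x y => C0.ext_real fun t => by
        simp only [prim_coe, ContinuousMap.add_apply, map_add]
        rw [intervalIntegral.integral_add (intervalIntegrable_coe x _ _)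
          (intervalIntegrable_coe y _ _)]
        ring
      map_smul' := fun c x => C0.ext_real fun t => by
        simp only [prim_coe, ContinuousMap.smul_apply, map_smul, smul_eq_mul, RingHom.id_apply]
        rw [intervalIntegral.integral_const_mul]
        ring } (1 + ‖mean‖) fun x => by
    refine (ContinuousMap.norm_le _ (by positivity)).2 fun t => ?_
    obtain ⟨s, hs, rfl⟩ := (AddCircle.coe_image_Icc_eq (1 : ℝ) 0).symm ▸ Set.mem_univ t
    rw [zero_add] at hs
    change ‖prim x (s : UnitAddCircle)‖ ≤ _
    rw [prim_coe]
    refine (norm_sub_le _ _).trans ?_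
    rw [add_mul, one_mul]
    have h1 := intervalIntegral.norm_integral_le_of_norm_le_const (a := 0) (b := s) (C := ‖x‖)
      (f := fun t : ℝ => x (t : UnitAddCircle)) fun t _ => x.norm_coe_le_norm t
    have h2 : |s - 0| ≤ 1 := by rw [sub_zero, abs_le]; constructor <;> linarith [hs.1, hs.2]
    have h3 : ‖s * mean x‖ ≤ ‖mean‖ * ‖x‖ := by
      rw [norm_mul]
      refine (mul_le_of_le_one_left (norm_nonneg _) ?_).trans (mean.le_opNorm x)
      simpa using h2
    exact add_le_add (h1.trans (mul_le_of_le_one_right (norm_nonneg _) h2)) h3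

theorem primL_apply (x : C0) : primL x = prim x := rfl

theorem prim_mem_C1 (x : C0) : ((primL x, x - mean x • 1) : C0 × C0) ∈ C1 := by
  intro t
  have h := (hasDerivAt_primitive x t).sub ((hasDerivAt_id t).mul_const (mean x))
  rw [one_mul] at h
  convert! h using 1
  simp

theorem mean_deriv {p : C0 × C0} (hp : p ∈ C1) : mean p.2 = 0 := by
  rw [mean_eq, intervalIntegral.integral_eq_sub_of_hasDerivAt (fun t _ => hp t)
    (intervalIntegrable_coe _ _ _)]
  have := periodic_coe p.1 0
  simp only [zero_add] at this
  rw [this, sub_self]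

theorem prim_deriv {p : C0 × C0} (hp : p ∈ C1) :
    primL p.2 = p.1 - p.1 ((0 : ℝ) : UnitAddCircle) • 1 := by
  refine C0.ext_real fun t => ?_
  rw [primL_apply, prim_coe, mean_deriv hp,
    intervalIntegral.integral_eq_sub_of_hasDerivAt (fun t _ => hp t)
    (intervalIntegrable_coe _ _ _)]
  simp

theorem primL_zero (x : C0) : primL x ((0 : ℝ) : UnitAddCircle) = 0 := by
  rw [primL_apply, prim_coe]; simp

theorem C1_mul {p r : C0 × C0} (hp : p ∈ C1) (hr : r ∈ C1) :
    ((p.1 * r.1, p.2 * r.1 + p.1 * r.2) : C0 × C0) ∈ C1 :=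
  fun t => (hp t).mul (hr t)

/-- With $P$ the periodic primitive, $P'=x-\bar x$, hence $(P^2/2)'=xP-\bar xP$. The average and the
primitive of this identity are the integrations by parts which keep the derivatives of the
functionals inside the ideals. -/
theorem half_prim_sq_mem_C1 (x : C0) :
    (((1 / 2 : ℝ) • (primL x * primL x), x * primL x - mean x • primL x) : C0 × C0) ∈ C1 := by
  have h := C1.smul_mem (1 / 2 : ℝ) (C1_mul (prim_mem_C1 x) (prim_mem_C1 x))
  convert! h using 1
  refine Prod.ext rfl ?_
  ext t
  simp
  ring

theorem mean_mul_prim (x : C0) : mean (x * primL x) = mean x * mean (primL x) := by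
  have := mean_deriv (half_prim_sq_mem_C1 x)
  rw [map_sub, map_smul, sub_eq_zero] at this
  simpa using this

theorem prim_mul_prim (x : C0) :
    primL (x * primL x) = (1 / 2 : ℝ) • (primL x * primL x) + mean x • primL (primL x) := by
  have := prim_deriv (half_prim_sq_mem_C1 x)
  rw [map_sub, map_smul, sub_eq_iff_eq_add] at this
  rw [this]
  simp only [ContinuousMap.smul_apply, ContinuousMap.mul_apply, primL_zero, mul_zero, smul_zero,
    zero_smul, sub_zero]

/-! ### Substitution operators -/

theorem IsSmooth.iteratedDeriv {f : UnitAddCircle → ℝ → ℝ} (hf : IsSmooth f) (j : ℕ) :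
    IsSmooth (fun t => iteratedDeriv j (f t)) := by
  have := AdaptedCoordinates.contDiffOn_dLast (X := ℝ) isOpen_univ (contDiffOn_univ.2 hf) j
  exact contDiffOn_univ.1 this

theorem IsSmooth.section {f : UnitAddCircle → ℝ → ℝ} (hf : IsSmooth f) (t : UnitAddCircle) :
    ContDiff ℝ ∞ (f t) := by
  induction t using QuotientAddGroup.induction_on with
  | H t => exact hf.comp (contDiff_const.prodMk contDiff_id : ContDiff ℝ ∞ fun y : ℝ => (t, y))

theorem continuous_substitute (f : UnitAddCircle → ℝ → ℝ) (hf : IsSmooth f) :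
    Continuous (substitute f hf) := by
  refine ContinuousMap.continuous_of_continuous_uncurry _ ?_
  exact hf.continuous.comp (continuous_snd.prodMk continuous_eval)

theorem IsSmooth.hasDerivAt_iteratedDeriv {f : UnitAddCircle → ℝ → ℝ} (hf : IsSmooth f) (j : ℕ)
    (t : UnitAddCircle) (y : ℝ) :
    HasDerivAt (_root_.iteratedDeriv j (f t)) (_root_.iteratedDeriv (j + 1) (f t) y) y := by
  rw [iteratedDeriv_succ]
  exact (((hf.iteratedDeriv j).section t).differentiable (by simp) y).hasDerivAt

/-- The operator `u ↦ D₂ʲ f(·, u(·))` on `C⁰(𝕊¹)`. -/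
def nem (f : UnitAddCircle → ℝ → ℝ) (hf : IsSmooth f) (j : ℕ) : C0 → C0 :=
  substitute (fun t => iteratedDeriv j (f t)) (hf.iteratedDeriv j)

theorem nem_apply (f : UnitAddCircle → ℝ → ℝ) (hf : IsSmooth f) (j : ℕ) (u : C0)
    (t : UnitAddCircle) : nem f hf j u t = iteratedDeriv j (f t) (u t) := rfl

theorem nem_coe (f : UnitAddCircle → ℝ → ℝ) (hf : IsSmooth f) (j : ℕ) (u : C0)
    (t : ℝ) : nem f hf j u (t : UnitAddCircle) = D2 f j u t := rfl

theorem nem_zero (f : UnitAddCircle → ℝ → ℝ) (hf : IsSmooth f) : nem f hf 0 = substitute f hf := by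
  funext u
  ext t
  simp [nem_apply, substitute]

/-- The mean value inequality on the segment from $u(t)$ to $u(t)+h(t)$, for each $t$; the bound is
uniform in $t$ because `nem f hf (j + 1)` is continuous in the sup norm. -/
theorem hasFDerivAt_nem (f : UnitAddCircle → ℝ → ℝ) (hf : IsSmooth f) (j : ℕ) (u : C0) :
    HasFDerivAt (nem f hf j) (ContinuousLinearMap.mul ℝ C0 (nem f hf (j + 1) u)) u := by
  rw [hasFDerivAt_iff_isLittleO_nhds_zero, Asymptotics.isLittleO_iff]
  intro ε hε
  have hc : ContinuousAt (nem f hf (j + 1)) u := (continuous_substitute _ _).continuousAt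
  obtain ⟨δ, hδ, hball⟩ := Metric.continuousAt_iff.1 hc ε hε
  filter_upwards [Metric.ball_mem_nhds (0 : C0) hδ] with h hh
  have hh' : ‖h‖ < δ := by simpa using hh
  refine (ContinuousMap.norm_le _ (by positivity)).2 fun t => ?_
  have hd : ∀ s ∈ Set.Icc (0 : ℝ) 1, HasDerivWithinAt
      (fun s : ℝ => iteratedDeriv j (f t) (u t + s * h t) - s * (nem f hf (j + 1) u t * h t))
      (iteratedDeriv (j + 1) (f t) (u t + s * h t) * h t - nem f hf (j + 1) u t * h t)
      (Set.Icc 0 1) s := by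
    intro s _
    have h1 : HasDerivAt (fun s : ℝ => u t + s * h t) (h t) s := by
      simpa using ((hasDerivAt_id s).mul_const (h t)).const_add (u t)
    have h2 := (hf.hasDerivAt_iteratedDeriv j t (u t + s * h t)).comp s h1
    have h3 : HasDerivAt (fun s : ℝ => s * (nem f hf (j + 1) u t * h t))
      (nem f hf (j + 1) u t * h t) s := by simpa using (hasDerivAt_id s).mul_const _
    exact (h2.sub h3).hasDerivWithinAt
  have hb := norm_image_sub_le_of_norm_deriv_le_segment_01' (C := ε * ‖h‖) hd ?_
  · have e : nem f hf j (u + h) t - nem f hf j u t - nem f hf (j + 1) u t * h t =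
        (iteratedDeriv j (f t) (u t + 1 * h t) - 1 * (nem f hf (j + 1) u t * h t)) -
          (iteratedDeriv j (f t) (u t + 0 * h t) - 0 * (nem f hf (j + 1) u t * h t)) := by
      simp only [nem_apply, ContinuousMap.add_apply, one_mul, zero_mul, add_zero]
      ring
    change ‖nem f hf j (u + h) t - nem f hf j u t - nem f hf (j + 1) u t * h t‖ ≤ _
    rw [e]
    exact hb
  · intro s hs
    rw [← sub_mul, norm_mul]
    refine mul_le_mul ?_ (h.norm_coe_le_norm t) (norm_nonneg _) hε.le
    have h1 : dist (u + s • h) u < δ := by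
      rw [dist_eq_norm, add_sub_cancel_left, norm_smul, Real.norm_of_nonneg hs.1]
      exact (mul_le_of_le_one_left (norm_nonneg _) hs.2.le).trans_lt hh'
    have h2 := (hball h1).le
    rw [dist_eq_norm] at h2
    exact ((nem f hf (j + 1) (u + s • h) - nem f hf (j + 1) u).norm_coe_le_norm t).trans h2

theorem contDiff_nem (f : UnitAddCircle → ℝ → ℝ) (hf : IsSmooth f) (j : ℕ) :
    ContDiff ℝ ∞ (nem f hf j) := by
  rw [contDiff_infty]
  intro n
  induction n generalizing j with
  | zero => exact contDiff_zero.2 (continuous_substitute _ _)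
  | succ n ih =>
    exact_mod_cast contDiff_succ_iff_hasFDerivAt.2
      ⟨_, (ContinuousLinearMap.contDiff _).comp (ih (j + 1)), hasFDerivAt_nem f hf j⟩

theorem isSmooth_exp : IsSmooth (fun _ => Real.exp) :=
  Real.contDiff_exp.comp contDiff_snd

/-- The exponential of a continuous function. -/
def expC : C0 → C0 := nem (fun _ => Real.exp) isSmooth_exp 0

@[simp]
theorem expC_apply (x : C0) (t : UnitAddCircle) : expC x t = Real.exp (x t) := by
  simp [expC, nem_apply]

theorem contDiff_expC : ContDiff ℝ ∞ expC := contDiff_nem _ _ _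

theorem hasFDerivAt_expC (x : C0) :
    HasFDerivAt expC (ContinuousLinearMap.mul ℝ C0 (expC x)) x := by
  have h := hasFDerivAt_nem (fun _ => Real.exp) isSmooth_exp 0 x
  convert! h using 2
  ext t
  simp [nem_apply, iteratedDeriv_succ]

end Calculus

/-! ### The functionals -/

section Functionals

variable (f : UnitAddCircle → ℝ → ℝ) (hf : IsSmooth f)

/-- The solution `w` of `w' + D₂f(t, u) w = w ∫ D₂f(t, u)` with `w(0) = 1`. -/
def kerFun (u : C0) : C0 := expC (-primL (nem f hf 1 u))

/-- The periodic primitive of `D₂²f(t, u) w`. -/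
def primW (u : C0) : C0 := primL (nem f hf 2 u * kerFun f hf u)

/-- The functionals obtained from `Σ₁, …, Σ₅` by replacing `kerVec` with `kerFun` and
`primitiveW` with `primW`; the index is shifted. -/
def sigma : ℕ → C0 → ℝ
  | 0, u => mean (nem f hf 1 u)
  | 1, u => mean (nem f hf 2 u * kerFun f hf u)
  | 2, u => mean (nem f hf 3 u * kerFun f hf u ^ 2)
  | 3, u => mean (nem f hf 4 u * kerFun f hf u ^ 3
      - (2 : ℝ) • (nem f hf 3 u * kerFun f hf u ^ 2 * primW f hf u))
  | 4, u => mean (nem f hf 5 u * kerFun f hf u ^ 4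
      - (5 : ℝ) • (nem f hf 4 u * kerFun f hf u ^ 3 * primW f hf u)
      + (5 : ℝ) • (nem f hf 3 u * kerFun f hf u ^ 2 * primW f hf u ^ 2))
  | _, _ => 0

theorem contDiff_kerFun : ContDiff ℝ ∞ (kerFun f hf) :=
  contDiff_expC.comp (primL.contDiff.comp (contDiff_nem f hf 1)).neg

theorem contDiff_primW : ContDiff ℝ ∞ (primW f hf) :=
  primL.contDiff.comp ((contDiff_nem f hf 2).mul (contDiff_kerFun f hf))

theorem contDiff_sigma (i : ℕ) : ContDiff ℝ ∞ (sigma f hf i) := by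
  have hw := contDiff_kerFun f hf
  have hA := contDiff_primW f hf
  have hN := contDiff_nem f hf
  match i with
  | 0 => exact mean.contDiff.comp (hN 1)
  | 1 => exact mean.contDiff.comp ((hN 2).mul hw)
  | 2 => exact mean.contDiff.comp ((hN 3).mul (hw.pow 2))
  | 3 => exact mean.contDiff.comp (((hN 4).mul (hw.pow 3)).sub
      ((((hN 3).mul (hw.pow 2)).mul hA).const_smul (2 : ℝ)))
  | 4 => exact mean.contDiff.comp ((((hN 5).mul (hw.pow 4)).sub
      ((((hN 4).mul (hw.pow 3)).mul hA).const_smul (5 : ℝ))).add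
      ((((hN 3).mul (hw.pow 2)).mul (hA.pow 2)).const_smul (5 : ℝ)))
  | (n + 5) => exact contDiff_const

theorem kerFun_coe (u : C0) (t : ℝ) : kerFun f hf u (t : UnitAddCircle) =
    Real.exp (-prim (nem f hf 1 u) (t : UnitAddCircle)) := by
  simp [kerFun, primL_apply]

theorem kerFun_pos (u : C0) (t : UnitAddCircle) : 0 < kerFun f hf u t := by
  simp [kerFun, Real.exp_pos]

theorem kerFun_mem_C1 (u : C0) : ((kerFun f hf u,
    sigma f hf 0 u • kerFun f hf u - nem f hf 1 u * kerFun f hf u) : C0 × C0) ∈ C1 := by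
  intro t
  have h := ((prim_mem_C1 (nem f hf 1 u)) t).neg.exp
  have e : (fun s : ℝ => kerFun f hf u (s : UnitAddCircle)) =
      fun s : ℝ => Real.exp (-primL (nem f hf 1 u) (s : UnitAddCircle)) := by
    funext s; rw [kerFun_coe, primL_apply]
  change HasDerivAt (fun s : ℝ => kerFun f hf u (s : UnitAddCircle)) _ t
  rw [e]
  convert! h using 1
  simp [kerFun_coe, primL_apply, sigma]
  ring

/-! #### Derivatives along `w` -/

section Line

variable (u : C0)

theorem hasDerivAt_nem_line (j : ℕ) (h : C0) :
    HasDerivAt (fun s : ℝ => nem f hf j (u + s • h)) (nem f hf (j + 1) u * h) 0 := by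
  have h1 : HasDerivAt (fun s : ℝ => u + s • h) h 0 := by
    simpa using ((hasDerivAt_id (0 : ℝ)).smul_const h).const_add u
  have h2 := (show HasFDerivAt (nem f hf j) _ (u + (0 : ℝ) • h) by
    simpa using hasFDerivAt_nem f hf j u).comp_hasDerivAt (0 : ℝ) h1
  convert! h2 using 1

/-- $\log w$ is minus the periodic primitive of $D_2f(t,u)$; its derivative along $w$ is minus that
of $D_2^2f\,w$, which is `primW`. -/
theorem hasDerivAt_kerFun_line :
    HasDerivAt (fun s : ℝ => kerFun f hf (u + s • kerFun f hf u))
      (-(kerFun f hf u * primW f hf u)) 0 := by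
  have h1 := (primL.hasFDerivAt.comp_hasDerivAt (0 : ℝ)
    (hasDerivAt_nem_line f hf u 1 (kerFun f hf u))).neg
  have h2 := (hasFDerivAt_expC _).comp_hasDerivAt (0 : ℝ) h1
  convert! h2 using 1
  simp [kerFun, primW]

theorem hasDerivAt_primW_line :
    HasDerivAt (fun s : ℝ => primW f hf (u + s • kerFun f hf u))
      (primL (nem f hf 3 u * kerFun f hf u ^ 2) -
        primL (nem f hf 2 u * kerFun f hf u * primW f hf u)) 0 := by
  have h1 := (hasDerivAt_nem_line f hf u 2 (kerFun f hf u)).mul (hasDerivAt_kerFun_line f hf u)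
  have h2 := primL.hasFDerivAt.comp_hasDerivAt (0 : ℝ) h1
  convert! h2 using 1
  rw [← map_sub]
  congr 1
  simp
  ring

theorem along_eq {q : C0 → ℝ} (hq : DifferentiableAt ℝ q u) {h : C0 → C0} {c : ℝ}
    (hc : HasDerivAt (fun s : ℝ => q (u + s • h u)) c 0) : along h q u = c := by
  have h1 : HasDerivAt (fun s : ℝ => u + s • h u) (h u) 0 := by
    simpa using ((hasDerivAt_id (0 : ℝ)).smul_const (h u)).const_add u
  have h2 := (show HasFDerivAt q (fderiv ℝ q u) (u + (0 : ℝ) • h u) by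
    simpa using hq.hasFDerivAt).comp_hasDerivAt (0 : ℝ) h1
  exact h2.unique hc

theorem along_sigma_zero : along (kerFun f hf) (sigma f hf 0) u = sigma f hf 1 u := by
  refine along_eq u ((contDiff_sigma f hf 0).differentiable (by simp) u) ?_
  exact mean.hasFDerivAt.comp_hasDerivAt (0 : ℝ) (hasDerivAt_nem_line f hf u 1 (kerFun f hf u))

/-- The product rule gives the averages of $D_2^3f\,w^2$ and $-D_2^2f\,w\,A$. As $A$ is the periodic
primitive of $D_2^2f\,w$, the second is $-\sigma_1\bar A$ by `mean_mul_prim`. -/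
theorem along_sigma_one : along (kerFun f hf) (sigma f hf 1) u =
    sigma f hf 2 u - mean (primW f hf u) * sigma f hf 1 u := by
  refine along_eq u ((contDiff_sigma f hf 1).differentiable (by simp) u) ?_
  have h1 := (hasDerivAt_nem_line f hf u 2 (kerFun f hf u)).mul (hasDerivAt_kerFun_line f hf u)
  have h2 := mean.hasFDerivAt.comp_hasDerivAt (0 : ℝ) h1
  convert! h2 using 1
  simp only [sigma, zero_smul, add_zero]
  have h3 := mean_mul_prim (nem f hf 2 u * kerFun f hf u)
  rw [mul_comm (mean (primW f hf u))]
  change _ - mean (nem f hf 2 u * kerFun f hf u) *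
    mean (primL (nem f hf 2 u * kerFun f hf u)) = _
  rw [← h3, ← map_sub]
  congr 1
  simp only [primW]
  ring

theorem along_sigma_two : along (kerFun f hf) (sigma f hf 2) u = sigma f hf 3 u := by
  refine along_eq u ((contDiff_sigma f hf 2).differentiable (by simp) u) ?_
  have h1 := (hasDerivAt_nem_line f hf u 3 (kerFun f hf u)).mul
    ((hasDerivAt_kerFun_line f hf u).pow 2)
  have h2 := mean.hasFDerivAt.comp_hasDerivAt (0 : ℝ) h1
  convert! h2 using 1
  simp only [sigma]
  congr 1
  ext t
  simp [-Nat.cast_ofNat]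
  ring

/-- The term $D_2^3f\,w^2A^2$ gets coefficient 4 from differentiating $w^2$ and 1 from
differentiating $A$, since the primitive of $D_2^2f\,w\,A$ is $A^2/2$ modulo $\sigma_1$: this is the
5 of $\Sigma_5$. The remaining product of $D_2^3f\,w^2$ with its own primitive averages to a
multiple of $\sigma_2$. -/
theorem along_sigma_three : along (kerFun f hf) (sigma f hf 3) u =
    sigma f hf 4 u - 2 * mean (primL (nem f hf 3 u * kerFun f hf u ^ 2)) * sigma f hf 2 u
      + 2 * mean (nem f hf 3 u * kerFun f hf u ^ 2 * primL (primW f hf u)) * sigma f hf 1 u := by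
  refine along_eq u ((contDiff_sigma f hf 3).differentiable (by simp) u) ?_
  have h1 := (hasDerivAt_nem_line f hf u 4 (kerFun f hf u)).mul
    ((hasDerivAt_kerFun_line f hf u).pow 3)
  have h2 := (((hasDerivAt_nem_line f hf u 3 (kerFun f hf u)).mul
    ((hasDerivAt_kerFun_line f hf u).pow 2)).mul (hasDerivAt_primW_line f hf u)).const_smul (2 : ℝ)
  have h3 := mean.hasFDerivAt.comp_hasDerivAt (0 : ℝ) (h1.sub h2)
  convert! h3 using 1
  have e1 := mean_mul_prim (nem f hf 3 u * kerFun f hf u ^ 2)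
  have e2 := prim_mul_prim (nem f hf 2 u * kerFun f hf u)
  change primL (nem f hf 2 u * kerFun f hf u * primW f hf u) =
    (1 / 2 : ℝ) • (primW f hf u * primW f hf u) + sigma f hf 1 u • primL (primW f hf u) at e2
  have e3 : sigma f hf 2 u = mean (nem f hf 3 u * kerFun f hf u ^ 2) := rfl
  have e4 : ∀ (c : ℝ) (x : C0), c * mean x = mean (c • x) := fun c x => by simp
  rw [e2, mul_assoc 2, mul_comm (mean (primL _)), e3, ← e1, mul_comm (2 * mean _) (sigma f hf 1 u), e4, e4,
    e4, show sigma f hf 4 u = mean _ from rfl]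
  rw [← map_sub, ← map_add]
  congr 1
  ext t
  simp [-Nat.cast_ofNat]
  ring

end Line

/-! #### Comparison with `Σ₁, …, Σ₅` -/

/-- The value of `kerVec` at `0`. -/
def kerScale (u : C0) : ℝ := Real.exp (mean (primL (nem f hf 1 u)))

theorem contDiff_kerScale : ContDiff ℝ ∞ (kerScale f hf) :=
  Real.contDiff_exp.comp (mean.contDiff.comp (primL.contDiff.comp (contDiff_nem f hf 1)))

/-- Integrate the derivative of $(s-\frac12)P(s)$ over a period, where $P$ is the periodic
primitive: the boundary terms vanish because $P(0)=P(1)=0$, and so does the integral of $s-\frac12$.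
-/
theorem mean_primL (x : C0) : mean (primL x) =
    -∫ s in (0 : ℝ)..1, (s - 1 / 2) * x (s : UnitAddCircle) := by
  have hx := continuous_coe x
  have hP := continuous_coe (primL x)
  have h0 := primL_zero x
  have h1 : primL x ((1 : ℝ) : UnitAddCircle) = 0 := by
    have := periodic_coe (primL x) 0
    simp only [zero_add] at this
    rw [this, h0]
  have hd : ∀ t ∈ Set.uIcc (0 : ℝ) 1,
      HasDerivAt (fun s : ℝ => (s - 1 / 2) * primL x (s : UnitAddCircle))
        (primL x (t : UnitAddCircle) + (t - 1 / 2) * x (t : UnitAddCircle)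
          - (t - 1 / 2) * mean x) t := by
    intro t _
    have := ((hasDerivAt_id t).sub_const (1 / 2)).mul (prim_mem_C1 x t)
    convert! this using 1
    simp
    ring
  have e := intervalIntegral.integral_eq_sub_of_hasDerivAt hd
    (Continuous.intervalIntegrable (by fun_prop) _ _)
  simp only [h0, h1, mul_zero, sub_zero] at e
  rw [intervalIntegral.integral_sub (Continuous.intervalIntegrable (by fun_prop) _ _)
    (Continuous.intervalIntegrable (by fun_prop) _ _),
    intervalIntegral.integral_add (Continuous.intervalIntegrable (by fun_prop) _ _)
    (Continuous.intervalIntegrable (by fun_prop) _ _), ← mean_eq,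
    intervalIntegral.integral_mul_const] at e
  have h2 : ∫ t in (0 : ℝ)..1, (t - 1 / 2) = 0 := by
    rw [intervalIntegral.integral_sub (by simp) (by simp)]
    simp
  rw [h2] at e
  linarith

/-- The kernel is $s-t+\frac12$ before $t$ and $s-t-\frac12$ after it; the unit jump accounts for
$\int_0^tx$. -/
theorem integral_green (x : C0) {t : ℝ} (ht : t ∈ Set.Icc (0 : ℝ) 1) :
    ∫ s in (0 : ℝ)..1, green (s - t) * x (s : UnitAddCircle) =
      prim x (t : UnitAddCircle) - mean (primL x) := by
  have hx := continuous_coe x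
  have ha : Set.EqOn (fun s : ℝ => (s - t + 1 / 2) * x (s : UnitAddCircle))
      (fun s : ℝ => green (s - t) * x (s : UnitAddCircle)) (Set.Ioo 0 t) := by
    intro s hs
    have : ⌊s - t⌋ = -1 := by
      rw [Int.floor_eq_iff]
      push_cast
      constructor <;> linarith [hs.1, hs.2, ht.1, ht.2]
    simp only [green, this]
    push_cast
    ring
  have hb : Set.EqOn (fun s : ℝ => (s - t - 1 / 2) * x (s : UnitAddCircle))
      (fun s : ℝ => green (s - t) * x (s : UnitAddCircle)) (Set.Ioo t 1) := by
    intro s hs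
    have : ⌊s - t⌋ = 0 := by
      rw [Int.floor_eq_iff]
      push_cast
      constructor <;> linarith [hs.1, hs.2, ht.1, ht.2]
    simp only [green, this]
    push_cast
    ring
  have ia : ∀ a b : ℝ, IntervalIntegrable (fun s : ℝ => (s - t + 1 / 2) * x (s : UnitAddCircle))
      volume a b := fun a b => Continuous.intervalIntegrable (by fun_prop) _ _
  have ib : ∀ a b : ℝ, IntervalIntegrable (fun s : ℝ => (s - t - 1 / 2) * x (s : UnitAddCircle))
      volume a b := fun a b => Continuous.intervalIntegrable (by fun_prop) _ _
  rw [← intervalIntegral.integral_add_adjacent_intervals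
    ((ia 0 t).congr_uIoo (by rwa [Set.uIoo_of_le ht.1]))
    ((ib t 1).congr_uIoo (by rwa [Set.uIoo_of_le ht.2])),
    ← intervalIntegral.integral_congr_Ioo_of_le ht.1 ha,
    ← intervalIntegral.integral_congr_Ioo_of_le ht.2 hb, mean_primL, prim_coe]
  have e1 : ∫ s in (0 : ℝ)..t, (s - t + 1 / 2) * x (s : UnitAddCircle) =
      (∫ s in (0 : ℝ)..t, (s - t - 1 / 2) * x (s : UnitAddCircle)) +
        ∫ s in (0 : ℝ)..t, x (s : UnitAddCircle) := by
    rw [← intervalIntegral.integral_add (ib _ _) (intervalIntegrable_coe x _ _)]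
    exact intervalIntegral.integral_congr fun s _ => by ring
  have e2 : ∫ s in (0 : ℝ)..1, (s - t - 1 / 2) * x (s : UnitAddCircle) =
      (∫ s in (0 : ℝ)..1, (s - 1 / 2) * x (s : UnitAddCircle)) - t * mean x := by
    rw [mean_eq, ← intervalIntegral.integral_const_mul, ← intervalIntegral.integral_sub
      (Continuous.intervalIntegrable (by fun_prop) _ _)
      (Continuous.intervalIntegrable (by fun_prop) _ _)]
    exact intervalIntegral.integral_congr fun s _ => by ring
  have e3 := intervalIntegral.integral_add_adjacent_intervals (ib 0 t) (ib t 1)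
  linarith

theorem kerVec_eq (u : C0) {t : ℝ} (ht : t ∈ Set.Icc (0 : ℝ) 1) :
    kerVec f u t = kerScale f hf u * kerFun f hf u (t : UnitAddCircle) := by
  have := integral_green (nem f hf 1 u) ht
  simp only [nem_coe] at this
  rw [kerVec, this, kerFun_coe, kerScale, ← Real.exp_add]
  congr 1
  ring

/-- Unlike `primW`, `primitiveW` need not be periodic: it grows by $\Sigma_2$ over a period, whence
the linear term. -/
theorem primitiveW_eq (u : C0) {t : ℝ} (ht : t ∈ Set.Icc (0 : ℝ) 1) :
    primitiveW f u t = kerScale f hf u *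
      (primW f hf u (t : UnitAddCircle) + t * sigma f hf 1 u) := by
  have h : primitiveW f u t = ∫ s in (0 : ℝ)..t, kerScale f hf u *
      (nem f hf 2 u * kerFun f hf u) (s : UnitAddCircle) := by
    refine intervalIntegral.integral_congr fun s hs => ?_
    rw [Set.uIcc_of_le ht.1] at hs
    simp only [kerVec_eq f hf u ⟨hs.1, hs.2.trans ht.2⟩, ContinuousMap.mul_apply, nem_coe]
    ring
  rw [h, intervalIntegral.integral_const_mul, primW, primL_apply, prim_coe]
  simp [sigma]

theorem integral_eq_mean_of_eq {g : ℝ → ℝ} {x : C0}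
    (h : ∀ t ∈ Set.Icc (0 : ℝ) 1, g t = x (t : UnitAddCircle)) :
    ∫ t in (0 : ℝ)..1, g t = mean x := by
  rw [mean_eq]
  refine intervalIntegral.integral_congr fun t ht => ?_
  rw [Set.uIcc_of_le zero_le_one] at ht
  exact h t ht

theorem Sig_one (u : C0) : Sig f 1 u = sigma f hf 0 u := by
  rw [sigma, mean_eq]
  rfl

theorem Sig_two (u : C0) : Sig f 2 u = kerScale f hf u * sigma f hf 1 u := by
  simp only [Sig, sigma]
  rw [← smul_eq_mul, ← map_smul]
  refine integral_eq_mean_of_eq fun t ht => ?_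
  simp only [kerVec_eq f hf u ht, ContinuousMap.smul_apply, ContinuousMap.mul_apply, nem_coe,
    smul_eq_mul]
  ring

theorem Sig_three (u : C0) : Sig f 3 u = kerScale f hf u ^ 2 * sigma f hf 2 u := by
  simp only [Sig, sigma]
  rw [← smul_eq_mul, ← map_smul]
  refine integral_eq_mean_of_eq fun t ht => ?_
  simp only [kerVec_eq f hf u ht, ContinuousMap.smul_apply, ContinuousMap.mul_apply, nem_coe,
    smul_eq_mul, ContinuousMap.pow_apply]
  ring

/-- When $\sigma_1=0$ the linear term of `primitiveW` disappears, and both terms of the integrand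
scale with the cube of `kerScale`. -/
theorem Sig_four (u : C0) (h : sigma f hf 1 u = 0) :
    Sig f 4 u = kerScale f hf u ^ 3 * sigma f hf 3 u := by
  simp only [Sig, sigma]
  rw [← smul_eq_mul, ← map_smul]
  refine integral_eq_mean_of_eq fun t ht => ?_
  simp only [kerVec_eq f hf u ht, primitiveW_eq f hf u ht, h, ContinuousMap.smul_apply,
    ContinuousMap.mul_apply, nem_coe, smul_eq_mul, ContinuousMap.pow_apply,
    ContinuousMap.sub_apply]
  ring

theorem Sig_five (u : C0) (h : sigma f hf 1 u = 0) :
    Sig f 5 u = kerScale f hf u ^ 4 * sigma f hf 4 u := by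
  simp only [Sig, sigma]
  rw [← smul_eq_mul, ← map_smul]
  refine integral_eq_mean_of_eq fun t ht => ?_
  simp only [kerVec_eq f hf u ht, primitiveW_eq f hf u ht, h, ContinuousMap.smul_apply,
    ContinuousMap.mul_apply, nem_coe, smul_eq_mul, ContinuousMap.pow_apply,
    ContinuousMap.sub_apply, ContinuousMap.add_apply]
  ring

end Functionals

/-! ### Periodic solutions of first order linear equations -/

section Linear

theorem exists_eq_zero_of_mean_eq_zero {x : C0} (hx : mean x = 0) :
    ∃ t : ℝ, x (t : UnitAddCircle) = 0 := by
  have hd := prim_mem_C1 x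
  have h1 := periodic_coe (primL x) 0
  simp only [zero_add] at h1
  obtain ⟨t, -, ht⟩ := exists_hasDerivAt_eq_zero (zero_lt_one (α := ℝ))
    (continuous_coe (primL x)).continuousOn h1.symm fun t _ => hd t
  exact ⟨t, by simpa [hx] using ht⟩

theorem hasDerivAt_exp_primitive_mul {k : ℝ → ℝ} {ρ : ℝ} {g : C0} {t : ℝ}
    (hk : HasDerivAt k (ρ - g (t : UnitAddCircle) * k t) t) :
    HasDerivAt (fun t : ℝ => Real.exp (∫ s in (0 : ℝ)..t, g (s : UnitAddCircle)) * k t)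
      (Real.exp (∫ s in (0 : ℝ)..t, g (s : UnitAddCircle)) * ρ) t := by
  have := (hasDerivAt_primitive g t).exp.mul hk
  convert! this using 1
  ring

theorem eq_zero_of_hasDerivAt {k : ℝ → ℝ} {g : C0} {t₀ : ℝ}
    (hk : ∀ t : ℝ, HasDerivAt k (-(g (t : UnitAddCircle) * k t)) t) (h0 : k t₀ = 0) (t : ℝ) :
    k t = 0 := by
  have hd : ∀ t : ℝ, HasDerivAt
      (fun t : ℝ => Real.exp (∫ s in (0 : ℝ)..t, g (s : UnitAddCircle)) * k t) 0 t := fun t => by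
    have := hasDerivAt_exp_primitive_mul (ρ := 0) (by simpa using hk t)
    simpa using this
  have := is_const_of_deriv_eq_zero (fun t => (hd t).differentiableAt) (fun t => (hd t).deriv) t t₀
  rw [h0, mul_zero] at this
  exact (mul_eq_zero.1 this).resolve_left (Real.exp_pos _).ne'

/-- A periodic solution of `z' + g z = c` with zero average vanishes, and then `c = 0`. -/
theorem eq_zero_of_mean_eq_zero {p : C0 × C0} (hp : p ∈ C1) {g : C0} {c : ℝ}
    (h : p.2 = c • 1 - g * p.1) (h0 : mean p.1 = 0) : p.1 = 0 ∧ c = 0 := by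
  obtain ⟨t₀, ht₀⟩ := exists_eq_zero_of_mean_eq_zero h0
  have hd : ∀ t : ℝ, HasDerivAt (fun s : ℝ => p.1 (s : UnitAddCircle))
      (c - g (t : UnitAddCircle) * p.1 (t : UnitAddCircle)) t := fun t => by
    have := hp t
    rw [h] at this
    simpa using this
  have hE := fun t : ℝ => hasDerivAt_exp_primitive_mul (hd t)
  have ht₁ : p.1 ((t₀ + 1 : ℝ) : UnitAddCircle) = 0 := (periodic_coe p.1 t₀).trans ht₀
  -- With the integrating factor $e^{\int g}$ the solution has derivative $c\,e^{\int g}$ and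
  -- vanishes at $t_0$ and $t_0+1$: Rolle.
  have hc : c = 0 := by
    obtain ⟨t, -, ht⟩ := exists_hasDerivAt_eq_zero (a := t₀) (b := t₀ + 1) (by linarith)
      (fun t _ => (hE t).continuousAt.continuousWithinAt) (by simp only [ht₀, ht₁, mul_zero])
      fun t _ => hE t
    exact (mul_eq_zero.1 ht).resolve_left (Real.exp_pos _).ne'
  refine ⟨C0.ext_real fun t => ?_, hc⟩
  exact eq_zero_of_hasDerivAt (k := fun s : ℝ => p.1 (s : UnitAddCircle))
    (fun t => by simpa [hc] using hd t) ht₀ t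

theorem exists_C1_of_hasDerivAt {k : ℝ → ℝ} {ρ g : C0}
    (hk : ∀ t : ℝ, HasDerivAt k (ρ (t : UnitAddCircle) - g (t : UnitAddCircle) * k t) t)
    (h01 : k 1 = k 0) :
    ∃ p ∈ C1, p.2 = ρ - g * p.1 ∧ ∀ t : ℝ, p.1 (t : UnitAddCircle) = k t := by
  have hper : Function.Periodic k 1 := by
    intro t
    -- By periodicity of the coefficients $k(t+1)-k(t)$ solves the homogeneous equation; it vanishes
    -- at $0$, hence everywhere.
    have hd : ∀ t : ℝ, HasDerivAt (fun t => k (t + 1) - k t)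
        (-(g (t : UnitAddCircle) * (k (t + 1) - k t))) t := by
      intro t
      have h1 := ((hk (t + 1)).comp_add_const t 1).sub (hk t)
      have h2 : ρ ((t + 1 : ℝ) : UnitAddCircle) = ρ (t : UnitAddCircle) := periodic_coe ρ t
      have h3 : g ((t + 1 : ℝ) : UnitAddCircle) = g (t : UnitAddCircle) := periodic_coe g t
      rw [h2, h3] at h1
      convert! h1 using 1
      ring
    exact sub_eq_zero.1 (eq_zero_of_hasDerivAt (k := fun t => k (t + 1) - k t) hd
      (t₀ := 0) (by simp [h01]) t)
  have hc : Continuous k := continuous_iff_continuousAt.2 fun t => (hk t).continuousAt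
  exact ⟨(periodicLift k hc hper, ρ - g * periodicLift k hc hper), fun t => hk t, rfl,
    fun t => rfl⟩

/-- The solution of `k' + g k = ρ` with `k(0) = 0`. -/
def duhamel (g ρ : C0) (t : ℝ) : ℝ :=
  Real.exp (-∫ s in (0 : ℝ)..t, g (s : UnitAddCircle)) *
    ∫ s in (0 : ℝ)..t, Real.exp (∫ r in (0 : ℝ)..s, g (r : UnitAddCircle)) * ρ (s : UnitAddCircle)

theorem hasDerivAt_duhamel (g ρ : C0) (t : ℝ) :
    HasDerivAt (duhamel g ρ)
      (ρ (t : UnitAddCircle) - g (t : UnitAddCircle) * duhamel g ρ t) t := by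
  have h1 := (hasDerivAt_primitive g t).fun_neg.exp
  have hc : Continuous fun s : ℝ => Real.exp (∫ r in (0 : ℝ)..s, g (r : UnitAddCircle)) *
      ρ (s : UnitAddCircle) :=
    (Real.continuous_exp.comp (continuous_iff_continuousAt.2 fun t =>
      (hasDerivAt_primitive g t).continuousAt)).mul (continuous_coe ρ)
  have h2 := h1.mul (hc.integral_hasStrictDerivAt 0 t).hasDerivAt
  convert! h2 using 1
  simp only [duhamel]
  rw [← mul_assoc (Real.exp _) (Real.exp _), ← Real.exp_add, neg_add_cancel, Real.exp_zero]
  ring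

theorem duhamel_zero (g ρ : C0) : duhamel g ρ 0 = 0 := by
  simp [duhamel]

theorem hasDerivAt_homogeneous (g : C0) (t : ℝ) :
    HasDerivAt (fun t : ℝ => Real.exp (-∫ s in (0 : ℝ)..t, g (s : UnitAddCircle)))
      (-(g (t : UnitAddCircle) * Real.exp (-∫ s in (0 : ℝ)..t, g (s : UnitAddCircle)))) t := by
  convert! (hasDerivAt_primitive g t).fun_neg.exp using 1
  ring

/-- Solvability of the linearization of `Ψ` in `C¹`. -/
theorem exists_C1_linearized (g r : C0) :
    ∃ p ∈ C1, p.2 + g * p.1 - mean (g * p.1) • 1 + mean p.1 • (1 : C0) = r := by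
  -- The solutions of $p'+gp=c+(r-\bar r)$ are $aE+cS+R$; the constants $a,c$ will be fixed by
  -- periodicity and by $\bar p=\bar r$.
  let E : ℝ → ℝ := fun t => Real.exp (-∫ s in (0 : ℝ)..t, g (s : UnitAddCircle))
  let S : ℝ → ℝ := duhamel g 1
  let R : ℝ → ℝ := duhamel g (r - mean r • 1)
  have hE : ∀ t, HasDerivAt E _ t := hasDerivAt_homogeneous g
  have hS : ∀ t, HasDerivAt S _ t := hasDerivAt_duhamel g 1
  have hR : ∀ t, HasDerivAt R _ t := hasDerivAt_duhamel g (r - mean r • 1)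
  have iE : IntervalIntegrable E volume 0 1 :=
    (continuous_iff_continuousAt.2 fun t => (hE t).continuousAt).intervalIntegrable _ _
  have iS : IntervalIntegrable S volume 0 1 :=
    (continuous_iff_continuousAt.2 fun t => (hS t).continuousAt).intervalIntegrable _ _
  have iR : IntervalIntegrable R volume 0 1 :=
    (continuous_iff_continuousAt.2 fun t => (hR t).continuousAt).intervalIntegrable _ _
  have hE0 : E 0 = 1 := by simp [E]
  have hS0 : S 0 = 0 := duhamel_zero _ _
  have hR0 : R 0 = 0 := duhamel_zero _ _
  let Λ : ℝ × ℝ →ₗ[ℝ] ℝ × ℝ :=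
    { toFun := fun x => (x.1 * (E 1 - 1) + x.2 * S 1,
        x.1 * (∫ t in (0 : ℝ)..1, E t) + x.2 * ∫ t in (0 : ℝ)..1, S t)
      map_add' := fun x y => by ext <;> simp <;> ring
      map_smul' := fun c x => by ext <;> simp <;> ring }
  -- The $2\times2$ system is uniquely solvable because a periodic solution of $z'+gz=c$ of average
  -- zero is trivial.
  have hinj : Function.Injective Λ := by
    refine (injective_iff_map_eq_zero Λ).2 ?_
    rintro ⟨a, c⟩ h
    have h1 : a * (E 1 - 1) + c * S 1 = 0 := congrArg Prod.fst h
    have h2 : a * (∫ t in (0 : ℝ)..1, E t) + c * ∫ t in (0 : ℝ)..1, S t = 0 :=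
      congrArg Prod.snd h
    obtain ⟨p, hp, hp2, hpk⟩ := exists_C1_of_hasDerivAt (k := fun t => a * E t + c * S t)
      (ρ := c • 1) (g := g) (fun t => by
        convert! ((hE t).const_mul a).add ((hS t).const_mul c) using 1
        simp [E, S]
        ring) (by simp only [hE0, hS0]; linarith)
    have hm : mean p.1 = 0 := by
      rw [mean_eq]
      simp only [hpk]
      rw [intervalIntegral.integral_add (iE.const_mul a) (iS.const_mul c),
        intervalIntegral.integral_const_mul, intervalIntegral.integral_const_mul, h2]
    obtain ⟨hp0, hc⟩ := eq_zero_of_mean_eq_zero hp hp2 hm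
    have ha : a = 0 := by
      have := hpk 0
      rw [hp0, hE0, hS0] at this
      simpa using this.symm
    simp [ha, hc]
  obtain ⟨⟨a, c⟩, hac⟩ := LinearMap.injective_iff_surjective.1 hinj
    (-R 1, mean r - ∫ t in (0 : ℝ)..1, R t)
  have h1 : a * (E 1 - 1) + c * S 1 = -R 1 := congrArg Prod.fst hac
  have h2 : a * (∫ t in (0 : ℝ)..1, E t) + c * (∫ t in (0 : ℝ)..1, S t) =
      mean r - ∫ t in (0 : ℝ)..1, R t := congrArg Prod.snd hac
  obtain ⟨p, hp, hp2, hpk⟩ := exists_C1_of_hasDerivAt (k := fun t => a * E t + c * S t + R t)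
    (ρ := c • 1 + (r - mean r • 1)) (g := g) (fun t => by
      convert! (((hE t).const_mul a).add ((hS t).const_mul c)).add (hR t) using 1
      simp [E, S, R]
      ring) (by simp only [hE0, hS0, hR0]; linarith)
  have hm : mean p.1 = mean r := by
    rw [mean_eq]
    simp only [hpk]
    rw [intervalIntegral.integral_add ((iE.const_mul a).add (iS.const_mul c)) iR,
      intervalIntegral.integral_add (iE.const_mul a) (iS.const_mul c),
      intervalIntegral.integral_const_mul, intervalIntegral.integral_const_mul, h2]
    ring
  -- Averaging the equation over the circle identifies the free constant $c$ with the nonlocal term.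
  have hg : mean (g * p.1) = c := by
    have := mean_deriv hp
    rw [hp2] at this
    simp only [map_sub, map_add, map_smul, mean_one, smul_eq_mul] at this
    linarith
  refine ⟨p, hp, ?_⟩
  rw [hg, hm, hp2]
  module

theorem exp_prim_mem_C1 (g : C0) : ((expC (primL g),
    g * expC (primL g) - mean g • expC (primL g)) : C0 × C0) ∈ C1 := by
  intro t
  have h := (prim_mem_C1 g t).exp
  simp only [expC_apply]
  convert! h using 1
  simp
  ring

/-- If `g` has nonzero average, then `z' + g z = 0` has no nonzero periodic solution. -/
theorem eq_zero_of_mean_ne_zero {p : C0 × C0} (hp : p ∈ C1) {g : C0}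
    (h : p.2 = -(g * p.1)) (hg : mean g ≠ 0) : p.1 = 0 := by
  have h1 := C1_mul hp (exp_prim_mem_C1 g)
  -- The product $y$ of $z$ with the periodic factor satisfies $y'+\bar g\,y=0$, so its average is
  -- zero and the previous uniqueness result applies with constant coefficient.
  have e : p.2 * expC (primL g) + p.1 * (g * expC (primL g) - mean g • expC (primL g)) =
      (0 : ℝ) • 1 - (mean g • (1 : C0)) * (p.1 * expC (primL g)) := by
    rw [h]
    ext t
    simp
    ring
  have h2 : mean (p.1 * expC (primL g)) = 0 := by
    have := mean_deriv h1
    simp only at this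
    rw [e, zero_smul, zero_sub, smul_mul_assoc, one_mul, map_neg, map_smul, neg_eq_zero] at this
    exact (smul_eq_zero.1 this).resolve_left hg
  obtain ⟨h3, -⟩ := eq_zero_of_mean_eq_zero h1 e h2
  ext t
  have := congrArg (fun x : C0 => x t) h3
  simp only [ContinuousMap.mul_apply, expC_apply, ContinuousMap.zero_apply] at this
  exact (mul_eq_zero.1 this).resolve_right (Real.exp_pos _).ne'

/-- If `g` has zero average, then `z' + g z = w` with `w = exp (- ∫ g)` has no periodic
solution. -/
theorem ne_expC_of_mean_eq_zero {p : C0 × C0} (hp : p ∈ C1) {g : C0} (hg : mean g = 0) :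
    p.2 + g * p.1 ≠ expC (-primL g) := by
  intro h
  have h1 := mean_deriv (C1_mul hp (exp_prim_mem_C1 g))
  -- The integrating factor turns the equation into $y'=1$, impossible for periodic $y$.
  have e : p.2 * expC (primL g) + p.1 * (g * expC (primL g) - mean g • expC (primL g)) = 1 := by
    rw [hg, zero_smul, sub_zero]
    have : p.2 * expC (primL g) + p.1 * (g * expC (primL g)) =
      (p.2 + g * p.1) * expC (primL g) := by ring
    rw [this, h]
    ext t
    simp [← Real.exp_add]
  simp only at h1
  rw [e, mean_one] at h1
  exact one_ne_zero h1

/-- Hadamard's lemma: $g$ is the integral of $D_2f$ along the segment from $v$ to $u$. It reduces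
injectivity of $\Psi$ to a linear equation. -/
theorem exists_substitute_sub_eq (f : UnitAddCircle → ℝ → ℝ) (hf : IsSmooth f) (u v : C0) :
    ∃ g : C0, substitute f hf u - substitute f hf v = g * (u - v) := by
  refine ⟨∫ s in (0 : ℝ)..1, nem f hf 1 (v + s • (u - v)), ?_⟩
  have hl : ∀ s : ℝ, HasDerivAt (fun s : ℝ => v + s • (u - v)) (u - v) s := fun s => by
    simpa using ((hasDerivAt_id s).smul_const (u - v)).const_add v
  have hd : ∀ s ∈ Set.uIcc (0 : ℝ) 1, HasDerivAt (fun s : ℝ => nem f hf 0 (v + s • (u - v)))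
      (nem f hf 1 (v + s • (u - v)) * (u - v)) s := fun s _ =>
    (hasFDerivAt_nem f hf 0 _).comp_hasDerivAt s (hl s)
  have hc : Continuous fun s : ℝ => nem f hf 1 (v + s • (u - v)) :=
    (contDiff_nem f hf 1).continuous.comp
      (continuous_iff_continuousAt.2 fun s => (hl s).continuousAt)
  have h1 := intervalIntegral.integral_eq_sub_of_hasDerivAt hd
    ((hc.mul continuous_const).intervalIntegrable _ _)
  have h2 := ((ContinuousLinearMap.mul ℝ C0).flip (u - v)).intervalIntegral_comp_comm
    (hc.intervalIntegrable (μ := volume) 0 1)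
  simp only [ContinuousLinearMap.flip_apply, ContinuousLinearMap.mul_apply'] at h2
  rw [← h2, h1, nem_zero]
  simp

end Linear

/-! ### The functionals along the kernel vector field -/

section

theorem InIdeal.comp_clm {Z W : Type*} [NormedAddCommGroup Z] [NormedSpace ℝ Z]
    [NormedAddCommGroup W] [NormedSpace ℝ W] (L : Z →L[ℝ] W) {z₀ : Z} {q : ℕ → W → ℝ} {n : ℕ}
    {g : W → ℝ} (h : InIdeal (L z₀) q n g) :
    InIdeal z₀ (fun j z => q j (L z)) n (fun z => g (L z)) := by
  obtain ⟨c, hc, hs⟩ := h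
  exact ⟨fun j z => c j (L z), fun j => (hc j).comp z₀ L.contDiff.contDiffAt,
    L.continuous.continuousAt.eventually hs⟩

variable (f : UnitAddCircle → ℝ → ℝ) (hf : IsSmooth f)

theorem inIdeal_along_sigma (x : C0) (j : ℕ) (hj : j < 4) :
    InIdeal x (sigma f hf) (j + 1)
      (fun u => along (kerFun f hf) (sigma f hf j) u - sigma f hf (j + 1) u) := by
  have hw := contDiff_kerFun f hf
  have hA := contDiff_primW f hf
  have hN := contDiff_nem f hf
  interval_cases j
  · simpa [along_sigma_zero] using InIdeal.zero
  · refine (InIdeal.mul (InIdeal.gen (j := 1) (by omega))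
      (mean.contDiff.comp hA).neg.contDiffAt).congr (Eventually.of_forall fun u => ?_)
    simp [along_sigma_one]
  · simpa [along_sigma_two] using InIdeal.zero
  · have h1 : ContDiff ℝ ∞ fun u => -(2 * mean (primL (nem f hf 3 u * kerFun f hf u ^ 2))) :=
      (contDiff_const.mul (mean.contDiff.comp (primL.contDiff.comp ((hN 3).mul (hw.pow 2))))).neg
    have h2 : ContDiff ℝ ∞ fun u =>
        2 * mean (nem f hf 3 u * kerFun f hf u ^ 2 * primL (primW f hf u)) :=
      contDiff_const.mul
        (mean.contDiff.comp (((hN 3).mul (hw.pow 2)).mul (primL.contDiff.comp hA)))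
    refine ((InIdeal.mul (InIdeal.gen (j := 2) (by omega)) h1.contDiffAt).add
      (InIdeal.mul (InIdeal.gen (j := 1) (by omega)) h2.contDiffAt)).congr
      (Eventually.of_forall fun u => ?_)
    simp only [along_sigma_three]
    ring

theorem kerScale_pos (u : C0) : 0 < kerScale f hf u := Real.exp_pos _

theorem Sig_eq_zero_iff (x : C0) (i : ℕ) (hi : i < 5) (h : ∀ j < i, sigma f hf j x = 0) :
    Sig f (i + 1) x = 0 ↔ sigma f hf i x = 0 := by
  have hs := (kerScale_pos f hf x).ne'
  interval_cases i
  · rw [Sig_one f hf]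
  · simp [Sig_two f hf, hs]
  · simp [Sig_three f hf, hs]
  · simp [Sig_four f hf x (h 1 (by omega)), hs]
  · simp [Sig_five f hf x (h 1 (by omega)), hs]

theorem forall_Sig_eq_zero_iff (x : C0) (k : ℕ) (hk : k ≤ 5) :
    (∀ i, 1 ≤ i → i ≤ k → Sig f i x = 0) ↔ ∀ i < k, sigma f hf i x = 0 := by
  constructor
  · intro h i
    induction i using Nat.strong_induction_on with
    | _ i ih =>
      intro hi
      exact (Sig_eq_zero_iff f hf x i (by omega) fun j hj => ih j hj (by omega)).1
        (h (i + 1) (by omega) (by omega))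
  · intro h i h1 hi
    obtain ⟨i, rfl⟩ : ∃ j, i = j + 1 := ⟨i - 1, by omega⟩
    exact (Sig_eq_zero_iff f hf x i (by omega) fun j hj => h j (by omega)).2 (h i (by omega))

theorem Sig_eq_of_lt_three (x : C0) (i : ℕ) (hi : i < 3) :
    Sig f (i + 1) x = kerScale f hf x ^ i * sigma f hf i x := by
  interval_cases i
  · simp [Sig_one f hf]
  · simp [Sig_two f hf]
  · simp [Sig_three f hf]

end

/-! ### The operator `u ↦ u' + f(t, u)` on an abstract pair of function spaces -/

/-- A pair of Banach spaces `B₁`, `B₀` of functions on the circle, with `C¹ ⊆ B₁ ⊆ C⁰ ⊆ B₀`,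
and the derivative `d : B₁ → B₀`. -/
structure DerivPair (B₁ B₀ : Type) [NormedAddCommGroup B₁] [NormedSpace ℝ B₁]
    [NormedAddCommGroup B₀] [NormedSpace ℝ B₀] where
  /-- the inclusion of `B₁` in `C⁰` -/
  ι : B₁ →L[ℝ] C0
  /-- the derivative -/
  d : B₁ →L[ℝ] B₀
  /-- the inclusion of `C⁰` in `B₀` -/
  e : C0 →L[ℝ] B₀
  /-- the average -/
  avg : B₀ →L[ℝ] ℝ
  /-- the constant function `1` -/
  one : B₁
  /-- the primitive -/
  prim : C0 →L[ℝ] B₁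
  eq_zero : ∀ u, ι u = 0 → d u = 0 → u = 0
  ι_one : ι one = 1
  d_one : d one = 0
  ι_prim : ∀ x, ι (prim x) = primL x
  d_prim : ∀ x, d (prim x) = e (x - mean x • 1)
  avg_e : ∀ x, avg (e x) = mean x
  avg_d : ∀ u, avg (d u) = 0
  exists_d_eq : ∀ v, ∃ u, d u = v - avg v • e 1
  -- Regularity: an element of $B_1$ with continuous derivative is $C^1$. It reduces injectivity and
  -- nonsolvability in $B_1$ to the $C^1$ statements on linear equations.
  exists_C1_of_d_eq : ∀ u x, d u = e x → ∃ p ∈ C1, p.2 = x ∧ p.1 = ι u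

namespace DerivPair

variable {B₁ B₀ : Type} [NormedAddCommGroup B₁] [NormedSpace ℝ B₁]
  [NormedAddCommGroup B₀] [NormedSpace ℝ B₀] (m : DerivPair B₁ B₀)
  (f : UnitAddCircle → ℝ → ℝ) (hf : IsSmooth f)

/-- The operator `F(u) = u' + f(t, u)`. -/
def op (u : B₁) : B₀ := m.d u + m.e (substitute f hf (m.ι u))

theorem contDiff_op : ContDiff ℝ ∞ (m.op f hf) := by
  have h := contDiff_nem f hf 0
  rw [nem_zero] at h
  exact m.d.contDiff.add (m.e.contDiff.comp (h.comp m.ι.contDiff))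

theorem hasFDerivAt_op (u : B₁) : HasFDerivAt (m.op f hf) (m.d + m.e.comp
    ((ContinuousLinearMap.mul ℝ C0 (nem f hf 1 (m.ι u))).comp m.ι)) u := by
  have h := hasFDerivAt_nem f hf 0 (m.ι u)
  rw [nem_zero] at h
  exact m.d.hasFDerivAt.add (m.e.hasFDerivAt.comp u (h.comp u m.ι.hasFDerivAt))

theorem fderiv_op_apply (u h : B₁) :
    fderiv ℝ (m.op f hf) u h = m.d h + m.e (nem f hf 1 (m.ι u) * m.ι h) := by
  rw [(m.hasFDerivAt_op f hf u).fderiv]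
  rfl

theorem avg_one : m.avg (m.e 1) = 1 := by rw [m.avg_e, mean_one]

theorem eq_zero_of_mem_C1 {p : C0 × C0} (hp : p ∈ C1) {u : B₁} (hd : m.d u = m.e p.2)
    (hι : p.1 = m.ι u) (h0 : p.1 = 0) : u = 0 := by
  refine m.eq_zero u (by rw [← hι, h0]) ?_
  have h2 : p.2 = 0 := C0.ext_real fun t => by
    have h := hp t
    rw [h0] at h
    exact h.unique (hasDerivAt_const t (0 : ℝ))
  rw [hd, h2, map_zero]

theorem exists_of_mem_C1 {p : C0 × C0} (hp : p ∈ C1) : ∃ u, m.ι u = p.1 ∧ m.d u = m.e p.2 := by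
  refine ⟨p.1 ((0 : ℝ) : UnitAddCircle) • m.one + m.prim p.2, ?_, ?_⟩
  · rw [map_add, map_smul, m.ι_one, m.ι_prim, prim_deriv hp]
    abel
  · rw [map_add, map_smul, m.d_one, m.d_prim, mean_deriv hp]
    simp

/-- The vector field on `B₁` given by `kerFun`. -/
def kerField (u : B₁) : B₁ :=
  m.one + m.prim (sigma f hf 0 (m.ι u) • kerFun f hf (m.ι u)
    - nem f hf 1 (m.ι u) * kerFun f hf (m.ι u))

theorem contDiff_kerField : ContDiff ℝ ∞ (m.kerField f hf) := by
  refine contDiff_const.add (m.prim.contDiff.comp ?_)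
  have h : ContDiff ℝ ∞ m.ι := m.ι.contDiff
  exact (((contDiff_sigma f hf 0).comp h).smul ((contDiff_kerFun f hf).comp h)).sub
    (((contDiff_nem f hf 1).comp h).mul ((contDiff_kerFun f hf).comp h))

theorem ι_kerField (u : B₁) : m.ι (m.kerField f hf u) = kerFun f hf (m.ι u) := by
  rw [kerField, map_add, m.ι_one, m.ι_prim]
  have h := prim_deriv (kerFun_mem_C1 f hf (m.ι u))
  simp only at h
  have h0 : kerFun f hf (m.ι u) ((0 : ℝ) : UnitAddCircle) = 1 := by
    rw [kerFun_coe, ← primL_apply, primL_zero]; simp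
  rw [h, h0]
  simp

theorem d_kerField (u : B₁) : m.d (m.kerField f hf u) =
    m.e (sigma f hf 0 (m.ι u) • kerFun f hf (m.ι u)
      - nem f hf 1 (m.ι u) * kerFun f hf (m.ι u)) := by
  rw [kerField, map_add, m.d_one, m.d_prim]
  have h := mean_deriv (kerFun_mem_C1 f hf (m.ι u))
  simp only at h
  rw [h]
  simp

theorem fderiv_op_kerField (u : B₁) : fderiv ℝ (m.op f hf) u (m.kerField f hf u) =
    sigma f hf 0 (m.ι u) • m.e (kerFun f hf (m.ι u)) := by
  rw [fderiv_op_apply, d_kerField, ι_kerField, ← map_add, sub_add_cancel, map_smul]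

theorem kerField_ne_zero (u : B₁) : m.kerField f hf u ≠ 0 := by
  intro h
  have h1 := m.ι_kerField f hf u
  rw [h, map_zero] at h1
  have h2 := kerFun_pos f hf (m.ι u) 0
  rw [← h1] at h2
  simp at h2

theorem fderiv_op_injective {u : B₁} (hu : sigma f hf 0 (m.ι u) ≠ 0) :
    Function.Injective (fderiv ℝ (m.op f hf) u) := by
  refine (injective_iff_map_eq_zero _).2 fun h hh => ?_
  rw [fderiv_op_apply, add_eq_zero_iff_eq_neg, ← map_neg] at hh
  obtain ⟨p, hp, hp2, hp1⟩ := m.exists_C1_of_d_eq h _ hh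
  rw [← hp2] at hh
  rw [← hp1] at hp2
  exact m.eq_zero_of_mem_C1 hp hh hp1 (eq_zero_of_mean_ne_zero hp hp2 hu)

theorem fderiv_op_ne {u : B₁} (hu : sigma f hf 0 (m.ι u) = 0) (h : B₁) :
    fderiv ℝ (m.op f hf) u h ≠ m.e (kerFun f hf (m.ι u)) := by
  intro hh
  rw [fderiv_op_apply, ← eq_sub_iff_add_eq, ← map_sub] at hh
  obtain ⟨p, hp, hp2, hp1⟩ := m.exists_C1_of_d_eq h _ hh
  refine ne_expC_of_mean_eq_zero hp (g := nem f hf 1 (m.ι u)) hu ?_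
  rw [hp2, hp1, sub_add_cancel]
  rfl

/-- The derivatives `D₂ⁱ μ` in any adapted coordinates generate the same chain of ideals as the
functionals `sigma`. -/
theorem triangularAt_dLast {X : Type} [NormedAddCommGroup X] [NormedSpace ℝ X] {u : B₁}
    (A : AdaptedCoordinates (m.op f hf) u X) (hu : sigma f hf 0 (m.ι u) = 0) (i : ℕ)
    (hi : i ≤ 4) : TriangularAt u (fun j v => sigma f hf j (m.ι v)) i
      (fun v => dLast A.μ (i + 1) (A.α v)) := by
  refine A.triangularAt_dLast (m.contDiff_op f hf) (m.contDiff_kerField f hf)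
    (n := fun u => m.e (kerFun f hf (m.ι u))) (q := fun j v => sigma f hf j (m.ι v))
    (m.e.contDiff.comp ((contDiff_kerFun f hf).comp m.ι.contDiff))
    (fun j => (contDiff_sigma f hf j).comp m.ι.contDiff)
    (m.fderiv_op_kerField f hf) (m.kerField_ne_zero f hf u) (m.fderiv_op_ne f hf hu) hu
    (N := 4) (fun j hj => ?_) i hi
  refine ((inIdeal_along_sigma f hf (m.ι u) j hj).comp_clm m.ι).congr
    (Eventually.of_forall fun v => ?_)
  have h := ((contDiff_sigma f hf j).differentiable (by simp) (m.ι v)).hasFDerivAt.comp v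
    m.ι.hasFDerivAt
  have h' : fderiv ℝ (fun v => sigma f hf j (m.ι v)) v = _ := h.fderiv
  simp only [along, h', ContinuousLinearMap.comp_apply, ι_kerField]

/-! ### Derivatives of `μ` versus the functionals, in arbitrary adapted coordinates -/

section Coordinates

variable {X : Type} [NormedAddCommGroup X] [NormedSpace ℝ X] {u : B₁}
  (A : AdaptedCoordinates (m.op f hf) u X) {k : ℕ}

theorem forall_dLast_eq_zero_iff (hk : k ≤ 5) :
    (∀ i, 1 ≤ i → i ≤ k → dLast A.μ i (A.α u) = 0) ↔ ∀ i < k, sigma f hf i (m.ι u) = 0 := by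
  rcases Nat.eq_zero_or_pos k with rfl | hk0
  · exact ⟨fun _ i hi => by omega, fun _ i h1 hi => by omega⟩
  have e : (∀ i, 1 ≤ i → i ≤ k → dLast A.μ i (A.α u) = 0) ↔
      ∀ i < k, dLast A.μ (i + 1) (A.α u) = 0 := by
    refine ⟨fun h i hi => h (i + 1) (by omega) (by omega), fun h i h1 hi => ?_⟩
    obtain ⟨i, rfl⟩ : ∃ j, i = j + 1 := ⟨i - 1, by omega⟩
    exact h i (by omega)
  rw [e]
  by_cases hu : sigma f hf 0 (m.ι u) = 0
  · exact TriangularAt.forall_eq_zero_iff (p := fun i v => dLast A.μ (i + 1) (A.α v))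
      (q := fun j v => sigma f hf j (m.ι v))
      fun i hi => m.triangularAt_dLast f hf A hu i (by omega)
  -- Off the critical set both conditions already fail at the first order.
  · have := A.dLast_one_ne_zero (m.contDiff_op f hf) (m.fderiv_op_injective f hf hu)
    exact ⟨fun h => absurd (h 0 hk0) this, fun h => absurd (h 0 hk0) hu⟩

theorem dLast_eq_zero_iff (hk0 : 1 ≤ k) (hk : k ≤ 4)
    (h : ∀ i < k, sigma f hf i (m.ι u) = 0) :
    dLast A.μ (k + 1) (A.α u) = 0 ↔ Sig f (k + 1) (m.ι u) = 0 := by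
  rw [Sig_eq_zero_iff f hf (m.ι u) k (by omega) h]
  exact (m.triangularAt_dLast f hf A (h 0 (by omega)) k hk).apply_eq h

theorem surjective_fderiv_dLast_iff (hk0 : 1 ≤ k) (hk : k ≤ 4)
    (h : ∀ i < k, sigma f hf i (m.ι u) = 0) :
    Function.Surjective
        (fderiv ℝ (fun (p : X × ℝ) (i : Fin (k - 1)) => dLast A.μ (i + 1) p) (A.α u)) ↔
      Function.Surjective
        (fderiv ℝ (fun v (i : Fin (k - 1)) => Sig f (i + 1) (m.ι v)) u) := by
  have hq : ∀ j, ContDiff ℝ ∞ fun v => sigma f hf j (m.ι v) :=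
    fun j => (contDiff_sigma f hf j).comp m.ι.contDiff
  have hqd : ∀ j, DifferentiableAt ℝ (fun v => sigma f hf j (m.ι v)) u :=
    fun j => (hq j).differentiable (by simp) u
  rw [A.surjective_fderiv_dLast_iff (m.contDiff_op f hf),
    TriangularAt.surjective_fderiv_iff (p := fun i v => dLast A.μ (i + 1) (A.α v))
      (q := fun j v => sigma f hf j (m.ι v))
      (fun i hi => m.triangularAt_dLast f hf A (h 0 (by omega)) i (by omega)) hqd
      (fun j hj => h j (by omega)),
    TriangularAt.surjective_fderiv_iff (p := fun i v => Sig f (i + 1) (m.ι v))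
      (q := fun j v => sigma f hf j (m.ι v)) (fun i hi => ?_) hqd (fun j hj => h j (by omega))]
  -- As $i+1\le k-1\le3$, the functionals agree up to this unit identically, not only at zeros of
  -- $\sigma_1$.
  refine ⟨fun v => kerScale f hf (m.ι v) ^ i,
    (((contDiff_kerScale f hf).comp m.ι.contDiff).pow i).contDiffAt,
    pow_ne_zero _ (kerScale_pos f hf _).ne',
    InIdeal.zero.congr (Eventually.of_forall fun v => ?_)⟩
  simp [Sig_eq_of_lt_three f hf (m.ι v) i (by omega)]

end Coordinates

/-! #### The diffeomorphism `Ψ` -/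

/-- The map `Ψ`. -/
abbrev psi : B₁ → B₀ := Psi (m.op f hf) (fun u => mean (m.ι u)) m.avg (m.e 1)

theorem psi_apply (u : B₁) : m.psi f hf u =
    (m.op f hf u - m.avg (m.op f hf u) • m.e 1) + mean (m.ι u) • m.e 1 := rfl

theorem avg_psi (u : B₁) : m.avg (m.psi f hf u) = mean (m.ι u) := by
  simp [psi_apply, m.avg_one]

/-- The average of $\Psi(u)$ is that of $u$, so $z=u-v$ has average zero; by Hadamard's lemma it
solves $z'+gz=c$, with $c$ the difference of the averages of $F(u)$ and $F(v)$. -/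
theorem psi_injective : Function.Injective (m.psi f hf) := by
  intro u v h
  have hm : mean (m.ι u) = mean (m.ι v) := by
    rw [← m.avg_psi f hf, ← m.avg_psi f hf, h]
  obtain ⟨g, hg⟩ := exists_substitute_sub_eq f hf (m.ι u) (m.ι v)
  rw [psi_apply, psi_apply, hm, add_left_inj, op, op] at h
  set c := m.avg (m.op f hf u) - m.avg (m.op f hf v) with hc
  have hd : m.d (u - v) = m.e (c • 1 - g * m.ι (u - v)) := by
    rw [map_sub m.ι, ← hg, map_sub, map_sub, map_sub, map_smul, hc, sub_smul]
    simp only [op]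
    have h' := sub_eq_zero.2 h
    rw [← sub_eq_zero, ← h']
    abel
  obtain ⟨p, hp, hp2, hp1⟩ := m.exists_C1_of_d_eq _ _ hd
  have h0 := (eq_zero_of_mean_eq_zero hp (g := g) (c := c) (by rw [hp2, hp1])
    (by rw [hp1, map_sub, map_sub, hm, sub_self])).1
  exact sub_eq_zero.1 (m.eq_zero_of_mem_C1 hp (by rw [hd, hp2]) hp1 h0)

/-- The derivative of `Ψ`. -/
def dpsi (u : B₁) : B₁ →L[ℝ] B₀ :=
  (fderiv ℝ (m.op f hf) u - (m.avg.comp (fderiv ℝ (m.op f hf) u)).smulRight (m.e 1)) +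
    (mean.comp m.ι).smulRight (m.e 1)

theorem hasFDerivAt_psi (u : B₁) : HasFDerivAt (m.psi f hf) (m.dpsi f hf u) u := by
  have h := ((m.contDiff_op f hf).differentiable (by simp) u).hasFDerivAt
  exact (h.sub ((m.avg.hasFDerivAt.comp u h).smul_const _)).add
    ((mean.hasFDerivAt.comp u m.ι.hasFDerivAt).smul_const _)

theorem contDiff_psi : ContDiff ℝ ∞ (m.psi f hf) := by
  have h := m.contDiff_op f hf
  exact (h.sub ((m.avg.contDiff.comp h).smul contDiff_const)).add
    ((mean.contDiff.comp m.ι.contDiff).smul contDiff_const)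

theorem dpsi_apply (u h : B₁) : m.dpsi f hf u h = fderiv ℝ (m.op f hf) u h -
    m.avg (fderiv ℝ (m.op f hf) u h) • m.e 1 + mean (m.ι h) • m.e 1 := rfl

theorem dpsi_eq (u h : B₁) : m.dpsi f hf u h = m.d h + m.e (nem f hf 1 (m.ι u) * m.ι h -
    mean (nem f hf 1 (m.ι u) * m.ι h) • 1 + mean (m.ι h) • 1) := by
  rw [dpsi_apply, fderiv_op_apply, map_add m.avg, m.avg_d, m.avg_e, map_add, map_sub, map_smul,
    map_smul, zero_add]
  abel

theorem dpsi_injective (u : B₁) : Function.Injective (m.dpsi f hf u) := by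
  refine (injective_iff_map_eq_zero _).2 fun h hh => ?_
  have hm : mean (m.ι h) = 0 := by
    have := congrArg m.avg hh
    rw [dpsi_apply] at this
    simpa [m.avg_one] using this
  rw [dpsi_eq, hm, add_eq_zero_iff_eq_neg, ← map_neg] at hh
  obtain ⟨p, hp, hp2, hp1⟩ := m.exists_C1_of_d_eq h _ hh
  have h0 := (eq_zero_of_mean_eq_zero hp (g := nem f hf 1 (m.ι u))
    (c := mean (nem f hf 1 (m.ι u) * m.ι h)) (by rw [hp2, hp1]; simp) (by rw [hp1, hm])).1
  exact m.eq_zero_of_mem_C1 hp (by rw [hh, hp2]) hp1 h0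

/-- A primitive of $v-\bar v$ absorbs the possibly discontinuous part of the right-hand side; what
remains is continuous and is solved in $C^1$. -/
theorem dpsi_surjective (u : B₁) : Function.Surjective (m.dpsi f hf u) := by
  intro v
  obtain ⟨h, hh⟩ := m.exists_d_eq v
  set g := nem f hf 1 (m.ι u) with hg
  obtain ⟨p, hp, hpr⟩ := exists_C1_linearized g
    (m.avg v • 1 - (g * m.ι h - mean (g * m.ι h) • 1 + mean (m.ι h) • 1))
  obtain ⟨l, hl, hl'⟩ := m.exists_of_mem_C1 hp
  refine ⟨h + l, ?_⟩
  rw [map_add, dpsi_eq, dpsi_eq, hl, hl', hh, ← hg, ← map_add m.e]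
  rw [show p.2 + (g * p.1 - mean (g * p.1) • 1 + mean p.1 • (1 : C0)) =
    p.2 + g * p.1 - mean (g * p.1) • 1 + mean p.1 • 1 by abel, hpr, map_sub m.e, map_smul]
  abel

/-- The splitting of `B₀` in functions of average zero and constants. -/
def splitting : B₀ ≃L[ℝ] m.avg.ker × ℝ :=
  ContinuousLinearEquiv.equivOfInverse
    (((ContinuousLinearMap.id ℝ B₀ - m.avg.smulRight (m.e 1)).codRestrict m.avg.ker fun v => by
      change m.avg (v - m.avg v • m.e 1) = 0
      simp [m.avg_one]).prod m.avg)
    (m.avg.ker.subtypeL.comp (ContinuousLinearMap.fst ℝ _ _) +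
      (ContinuousLinearMap.snd ℝ _ _).smulRight (m.e 1))
    (fun v => by
      change (v - m.avg v • m.e 1) + m.avg v • m.e 1 = v
      simp)
    (fun p => by
      have h : m.avg (p.1 : B₀) = 0 := p.1.2
      have h' : m.avg ((p.1 : B₀) + p.2 • m.e 1) = p.2 := by simp [h, m.avg_one]
      refine Prod.ext (Subtype.ext ?_) h'
      change ((p.1 : B₀) + p.2 • m.e 1) - m.avg ((p.1 : B₀) + p.2 • m.e 1) • m.e 1 = p.1
      rw [h']
      simp)

theorem splitting_fst (v : B₀) : ((m.splitting v).1 : B₀) = v - m.avg v • m.e 1 := rfl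

/-! ### `Ψ` as adapted coordinates -/

variable [CompleteSpace B₁] [CompleteSpace B₀]

/-- The derivative of `Ψ` as an isomorphism. -/
def dpsiEquiv (u : B₁) : B₁ ≃L[ℝ] B₀ :=
  ContinuousLinearEquiv.ofBijective (m.dpsi f hf u)
    (LinearMap.ker_eq_bot.2 (m.dpsi_injective f hf u))
    (LinearMap.range_eq_top.2 (m.dpsi_surjective f hf u))

theorem hasFDerivAt_psi_equiv (u : B₁) :
    HasFDerivAt (m.psi f hf) (m.dpsiEquiv f hf u : B₁ →L[ℝ] B₀) u := by
  rw [dpsiEquiv, ContinuousLinearEquiv.coe_ofBijective]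
  exact m.hasFDerivAt_psi f hf u

/-- The restriction of `Ψ` to a neighborhood of `u`, as a local homeomorphism. -/
def psiHomeo (u : B₁) : OpenPartialHomeomorph B₁ B₀ :=
  ContDiffAt.toOpenPartialHomeomorph (m.psi f hf) (m.contDiff_psi f hf).contDiffAt
    (m.hasFDerivAt_psi_equiv f hf u) (by simp)

theorem psiHomeo_coe (u : B₁) : ⇑(m.psiHomeo f hf u) = m.psi f hf := rfl

theorem mem_psiHomeo_source (u : B₁) : u ∈ (m.psiHomeo f hf u).source :=
  ContDiffAt.mem_toOpenPartialHomeomorph_source (m.contDiff_psi f hf).contDiffAt _ _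

theorem contDiffOn_psiHomeo_symm (u : B₁) :
    ContDiffOn ℝ ∞ (m.psiHomeo f hf u).symm (m.psiHomeo f hf u).target := fun _ hv =>
  ((m.psiHomeo f hf u).contDiffAt_symm hv (m.hasFDerivAt_psi_equiv f hf _)
    (m.contDiff_psi f hf).contDiffAt).contDiffWithinAt

/-- The adapted coordinates given by `Ψ`. -/
def coordinates (u : B₁) : AdaptedCoordinates (m.op f hf) u m.avg.ker where
  α := (m.psiHomeo f hf u).transHomeomorph m.splitting.toHomeomorph
  β := m.splitting.toHomeomorph.toOpenPartialHomeomorph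
  mem_source := m.mem_psiHomeo_source f hf u
  mapsTo := fun _ _ => Set.mem_univ _
  contDiffOn_α := (m.splitting.contDiff.comp (m.contDiff_psi f hf)).contDiffOn
  contDiffOn_α_symm := (m.contDiffOn_psiHomeo_symm f hf u).comp m.splitting.symm.contDiff.contDiffOn
    fun _ hp => hp
  contDiffOn_β := m.splitting.contDiff.contDiffOn
  contDiffOn_β_symm := m.splitting.symm.contDiff.contDiffOn
  fst_eq := fun z _ => by
    refine Subtype.ext ?_
    change ((m.splitting (m.op f hf z)).1 : B₀) = ((m.splitting (m.psi f hf z)).1 : B₀)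
    rw [splitting_fst, splitting_fst, avg_psi, psi_apply]
    abel

/-- Adding a constant changes only the last coordinate after `splitting`. Near $a=0$ the global
`Function.invFun` is the local smooth inverse, because $\Psi$ is injective. -/
theorem iteratedDeriv_phi (u : B₁) (i : ℕ) :
    iteratedDeriv i (fun a : ℝ => phi (m.op f hf) (fun u => mean (m.ι u)) m.avg (m.e 1)
      (m.psi f hf u + a • m.e 1)) 0 =
    dLast (m.coordinates f hf u).μ i ((m.coordinates f hf u).α u) := by
  set A := m.coordinates f hf u with hA
  have h1 : dLast A.μ i (A.α u) =
      iteratedDeriv i (fun a : ℝ => A.μ ((A.α u).1, (A.α u).2 + a)) 0 := by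
    rw [iteratedDeriv_comp_const_add i (fun y => A.μ ((A.α u).1, y))]
    simp [dLast]
  rw [h1]
  refine Filter.EventuallyEq.iteratedDeriv_eq i ?_
  have hc : ContinuousAt (fun a : ℝ => m.psi f hf u + a • m.e 1) 0 := by fun_prop
  have ht : ∀ᶠ a : ℝ in 𝓝 0, m.psi f hf u + a • m.e 1 ∈ (m.psiHomeo f hf u).target := by
    refine hc.eventually ((m.psiHomeo f hf u).open_target.mem_nhds ?_)
    change m.psi f hf u + (0 : ℝ) • m.e 1 ∈ _
    rw [zero_smul, add_zero]
    exact (m.psiHomeo f hf u).map_source (m.mem_psiHomeo_source f hf u)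
  filter_upwards [ht] with a ha
  have h2 : Function.invFun (m.psi f hf) (m.psi f hf u + a • m.e 1) =
      (m.psiHomeo f hf u).symm (m.psi f hf u + a • m.e 1) := by
    apply m.psi_injective f hf
    have := (m.psiHomeo f hf u).right_inv ha
    rw [psiHomeo_coe] at this
    rw [Function.invFun_eq ⟨_, this⟩, this]
  have h3 : m.splitting.symm ((A.α u).1, (A.α u).2 + a) = m.psi f hf u + a • m.e 1 := by
    change ((m.splitting (m.psi f hf u)).1 : B₀) + (m.avg (m.psi f hf u) + a) • m.e 1 = _
    rw [splitting_fst, add_smul]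
    abel
  change m.avg (m.op f hf (Function.invFun (m.psi f hf) _)) =
    m.avg (m.op f hf ((m.psiHomeo f hf u).symm (m.splitting.symm ((A.α u).1, (A.α u).2 + a))))
  rw [h2, h3]

/-! ### The statements for an abstract pair of spaces -/

theorem stratum_eq (k : ℕ) (hk : k ≤ 5) :
    stratum (m.op f hf) (fun u => mean (m.ι u)) m.avg (m.e 1) k =
      {u : B₁ | ∀ i, 1 ≤ i → i ≤ k → Sig f i (m.ι u) = 0} := by
  ext u
  rw [Set.mem_ofPred_eq, forall_Sig_eq_zero_iff f hf (m.ι u) k hk,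
    ← m.forall_dLast_eq_zero_iff f hf (m.coordinates f hf u) hk]
  simp only [stratum, Set.mem_ofPred_eq, ← iteratedDeriv_phi]

theorem isMorinSingularity_iff (k : ℕ) (hk0 : 1 ≤ k) (hk : k ≤ 4) (u : B₁) :
    IsMorinSingularity (m.op f hf) k u ↔
      (∀ i, 1 ≤ i → i ≤ k → Sig f i (m.ι u) = 0) ∧ Sig f (k + 1) (m.ι u) ≠ 0 ∧
        Function.Surjective
          (fderiv ℝ (fun v (i : Fin (k - 1)) => Sig f (i + 1) (m.ι v)) u) := by
  constructor
  · rintro ⟨-, -, -, -, X, _, _, _, A, h1, h2, h3⟩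
    have hs := (m.forall_dLast_eq_zero_iff f hf A (by omega)).1 h1
    exact ⟨(forall_Sig_eq_zero_iff f hf (m.ι u) k (by omega)).2 hs,
      mt (m.dLast_eq_zero_iff f hf A hk0 hk hs).2 h2,
      (m.surjective_fderiv_dLast_iff f hf A hk0 hk hs).1 h3⟩
  · rintro ⟨h1, h2, h3⟩
    have hs := (forall_Sig_eq_zero_iff f hf (m.ι u) k (by omega)).1 h1
    have h0 : fderiv ℝ (m.op f hf) u (m.kerField f hf u) = 0 := by
      rw [fderiv_op_kerField, hs 0 (by omega), zero_smul]
    -- $DF$ and $D\Psi$ differ only in the direction of the constants, and $D\Psi$ is an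
    -- isomorphism.
    have hL : ∀ h, fderiv ℝ (m.op f hf) u h = m.dpsiEquiv f hf u h +
        (m.avg.comp (fderiv ℝ (m.op f hf) u) - mean.comp m.ι) h • m.e 1 := by
      intro h
      change _ = m.dpsi f hf u h +
        (m.avg (fderiv ℝ (m.op f hf) u h) - mean (m.ι h)) • m.e 1
      rw [dpsi_apply, sub_smul]
      abel
    have hr := finrank_of_rank_one_perturbation _ _ _ _ hL (m.kerField_ne_zero f hf u) h0
    have hc : CompleteSpace m.avg.ker :=
      (m.avg.isClosed_ker).completeSpace_coe
    exact ⟨m.contDiff_op f hf, isFredholm_of_rank_one_perturbation _ _ _ _ hL, hr.1, hr.2,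
      m.avg.ker, inferInstance, inferInstance, hc, m.coordinates f hf u,
      (m.forall_dLast_eq_zero_iff f hf _ (by omega)).2 hs,
      mt (m.dLast_eq_zero_iff f hf _ hk0 hk hs).1 h2,
      (m.surjective_fderiv_dLast_iff f hf _ hk0 hk hs).2 h3⟩

end DerivPair

/-! ### The pair `C¹`, `C⁰` -/

/-- The differential condition is equivalent to its integral form, an equality of continuous
functions of the pair. -/
theorem isClosed_C1 : IsClosed (C1 : Set (C0 × C0)) := by
  have h : (C1 : Set (C0 × C0)) = {p | p.1 - p.1 ((0 : ℝ) : UnitAddCircle) • 1 = primL p.2} ∩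
      {p | mean p.2 = 0} := by
    ext p
    refine ⟨fun hp => ⟨(prim_deriv hp).symm, mean_deriv hp⟩, fun ⟨h1, h2⟩ => ?_⟩
    have h1' : p.1 = p.1 ((0 : ℝ) : UnitAddCircle) • 1 + primL p.2 :=
      eq_add_of_sub_eq' h1
    have h2' : mean p.2 = 0 := h2
    intro t
    have h3 := (prim_mem_C1 p.2 t).const_add (p.1 ((0 : ℝ) : UnitAddCircle))
    convert! h3 using 1
    · funext s
      conv_lhs => rw [h1']
      simp
    · simp [h2']
  rw [h]
  refine (isClosed_eq ?_ ?_).inter (isClosed_eq ?_ continuous_const)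
  · have h1 : Continuous fun p : C0 × C0 => p.1 ((0 : ℝ) : UnitAddCircle) :=
      (continuous_eval_const _).comp continuous_fst
    exact continuous_fst.sub (h1.smul continuous_const)
  · exact primL.continuous.comp continuous_snd
  · exact mean.continuous.comp continuous_snd

instance : CompleteSpace C1 := isClosed_C1.completeSpace_coe

/-- The pair `C¹`, `C⁰`. -/
def pairC : DerivPair C1 C0 where
  ι := LinearMap.mkContinuous
    { toFun := fun u => u.1.1
      map_add' := fun _ _ => rfl
      map_smul' := fun _ _ => rfl } 1 fun u => by
    rw [one_mul]; exact norm_fst_le u.1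
  d := LinearMap.mkContinuous
    { toFun := fun u => u.1.2
      map_add' := fun _ _ => rfl
      map_smul' := fun _ _ => rfl } 1 fun u => by
    rw [one_mul]; exact norm_snd_le u.1
  e := ContinuousLinearMap.id ℝ C0
  avg := mean
  one := ⟨(1, 0), fun t => hasDerivAt_const t (1 : ℝ)⟩
  prim := LinearMap.mkContinuous
    { toFun := fun x => ⟨(primL x, x - mean x • 1), prim_mem_C1 x⟩
      map_add' := fun x y => Subtype.ext (Prod.ext (map_add primL x y) (by
        change (x + y) - mean (x + y) • (1 : C0) = (x - mean x • 1) + (y - mean y • 1)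
        rw [map_add]; module))
      map_smul' := fun c x => Subtype.ext (Prod.ext (map_smul primL c x) (by
        change (c • x) - mean (c • x) • (1 : C0) = c • (x - mean x • 1)
        rw [map_smul, smul_sub, smul_assoc])) }
    (max ‖primL‖ ‖ContinuousLinearMap.id ℝ C0 - mean.smulRight (1 : C0)‖) fun x => by
    refine max_le ?_ ?_
    · exact (primL.le_opNorm x).trans
        (mul_le_mul_of_nonneg_right (le_max_left _ _) (norm_nonneg _))
    · exact ((ContinuousLinearMap.id ℝ C0 - mean.smulRight (1 : C0)).le_opNorm x).trans
        (mul_le_mul_of_nonneg_right (le_max_right _ _) (norm_nonneg _))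
  eq_zero := fun _ h1 h2 => Subtype.ext (Prod.ext h1 h2)
  ι_one := rfl
  d_one := rfl
  ι_prim := fun _ => rfl
  d_prim := fun _ => rfl
  avg_e := fun _ => rfl
  avg_d := fun u => mean_deriv u.2
  exists_d_eq := fun v => ⟨⟨(primL v, v - mean v • 1), prim_mem_C1 v⟩, rfl⟩
  exists_C1_of_d_eq := fun u _ h => ⟨u.1, u.2, h, rfl⟩

/-! ### The pair `H¹`, `L²` -/

theorem integral_norm_le_norm_L2 (v : L2) : ∫ t, ‖v t‖ ≤ ‖v‖ := by
  have : IsProbabilityMeasure (volume : Measure UnitAddCircle) := ⟨UnitAddCircle.measure_univ⟩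
  have h1 := eLpNorm_le_eLpNorm_of_exponent_le (μ := (volume : Measure UnitAddCircle))
    (p := 1) (q := 2) (by norm_num) (Lp.aestronglyMeasurable v)
  rw [integral_norm_eq_lintegral_enorm (Lp.aestronglyMeasurable v),
    ← eLpNorm_one_eq_lintegral_enorm,
    Lp.norm_def]
  exact ENNReal.toReal_mono (Lp.eLpNorm_ne_top v) h1

theorem integrable_L2 (v : L2) : Integrable (v : UnitAddCircle → ℝ) volume :=
  (Lp.memLp v).integrable (by norm_num)

/-- The average of a function in `L²(𝕊¹)`. -/
def meanL2 : L2 →L[ℝ] ℝ :=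
  LinearMap.mkContinuous
    { toFun := fun v => ∫ t, v t
      map_add' := fun v w => by
        rw [← integral_add (integrable_L2 v) (integrable_L2 w)]
        exact integral_congr_ae (Lp.coeFn_add v w)
      map_smul' := fun c v => by
        rw [RingHom.id_apply, smul_eq_mul, ← integral_const_mul]
        exact integral_congr_ae (Lp.coeFn_smul c v) } 1 fun v => by
    rw [one_mul]
    exact (norm_integral_le_integral_norm _).trans (integral_norm_le_norm_L2 v)

theorem meanL2_eq (v : L2) : meanL2 v = ∫ t in (0 : ℝ)..1, v (t : UnitAddCircle) :=
  integral_circle_eq _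

/-- The inclusion of `C⁰` in `L²`. -/
def toL2 : C0 →L[ℝ] L2 := ContinuousMap.toLp 2 volume ℝ

theorem integral_toL2 (x : C0) {t : ℝ} (ht : t ∈ Set.Icc (0 : ℝ) 1) :
    ∫ s in (0 : ℝ)..t, toL2 x (s : UnitAddCircle) = ∫ s in (0 : ℝ)..t, x (s : UnitAddCircle) :=
  integral_L2_congr ht (ae_Ioc_of_ae (ContinuousMap.coeFn_toLp volume x))

theorem one_mem_Icc : (1 : ℝ) ∈ Set.Icc (0 : ℝ) 1 := ⟨zero_le_one, le_rfl⟩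

theorem mem_H1_of_mem_C1 {p : C0 × C0} (hp : p ∈ C1) : ((p.1, toL2 p.2) : C0 × L2) ∈ H1 := by
  intro t ht
  change p.1 (t : UnitAddCircle) = _
  rw [integral_toL2 p.2 ht, intervalIntegral.integral_eq_sub_of_hasDerivAt (fun t _ => hp t)
    (intervalIntegrable_coe _ _ _)]
  ring

theorem eq_of_forall_mem_Icc {x y : C0}
    (h : ∀ t ∈ Set.Icc (0 : ℝ) 1, x (t : UnitAddCircle) = y (t : UnitAddCircle)) : x = y := by
  ext t
  obtain ⟨s, hs, rfl⟩ := (AddCircle.coe_image_Icc_eq (1 : ℝ) 0).symm ▸ Set.mem_univ t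
  rw [zero_add] at hs
  exact h s hs

theorem meanL2_deriv {p : C0 × L2} (hp : p ∈ H1) : meanL2 p.2 = 0 := by
  have h := hp 1 one_mem_Icc
  have h1 := periodic_coe p.1 0
  simp only [zero_add] at h1
  rw [h1, ← meanL2_eq] at h
  linarith

/-- The integral of a continuous function is differentiable at every point, and its average zero
makes the periodic primitive the ordinary one. -/
theorem mem_C1_of_mem_H1 {u x : C0} (h : ((u, toL2 x) : C0 × L2) ∈ H1) :
    ((u, x) : C0 × C0) ∈ C1 := by
  have hm : mean x = 0 := by
    rw [← meanL2_deriv h, meanL2_eq, mean_eq]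
    exact (integral_toL2 x one_mem_Icc).symm
  have hu : u = u ((0 : ℝ) : UnitAddCircle) • 1 + primL x := by
    refine eq_of_forall_mem_Icc fun t ht => ?_
    have h1 : u (t : UnitAddCircle) = u ((0 : ℝ) : UnitAddCircle) +
      ∫ s in (0 : ℝ)..t, toL2 x (s : UnitAddCircle) := h t ht
    rw [integral_toL2 x ht] at h1
    simp [primL_apply, prim_coe, hm, h1]
  have h1 : ((1, 0) : C0 × C0) ∈ C1 := fun t => hasDerivAt_const t (1 : ℝ)
  have h2 := C1.add_mem (C1.smul_mem (u ((0 : ℝ) : UnitAddCircle)) h1) (prim_mem_C1 x)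
  convert! h2 using 1
  refine Prod.ext hu ?_
  simp [hm]

theorem exists_primitive_L2 (v : L2) : ∃ u : H1, u.1.2 = v - meanL2 v • toL2 1 := by
  have hp : Function.Periodic (fun t : ℝ => v (t : UnitAddCircle)) 1 := fun t => by simp
  have hi : ∀ a b : ℝ, IntervalIntegrable (fun t : ℝ => v (t : UnitAddCircle)) volume a b :=
    hp.intervalIntegrable₀ one_ne_zero (intervalIntegrable_L2 v one_mem_Icc)
  have hc : Continuous fun t : ℝ => (∫ s in (0 : ℝ)..t, v (s : UnitAddCircle)) - t * meanL2 v :=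
    (intervalIntegral.continuous_primitive hi 0).sub (continuous_id.mul continuous_const)
  have hper : Function.Periodic
      (fun t : ℝ => (∫ s in (0 : ℝ)..t, v (s : UnitAddCircle)) - t * meanL2 v) 1 := by
    intro t
    have h1 := hp.intervalIntegral_add_eq_add 0 t hi
    simp only [zero_add] at h1
    simp only [h1, ← meanL2_eq]
    ring
  refine ⟨⟨(periodicLift _ hc hper, v - meanL2 v • toL2 1), fun t ht => ?_⟩, rfl⟩
  have hsub := integral_L2_congr ht (ae_Ioc_of_ae (Lp.coeFn_sub v (meanL2 v • toL2 1)))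
  have hsmul := integral_L2_congr ht (ae_Ioc_of_ae (Lp.coeFn_smul (meanL2 v) (toL2 1)))
  simp only [Pi.sub_apply] at hsub
  simp only [Pi.smul_apply, smul_eq_mul] at hsmul
  rw [intervalIntegral.integral_sub (intervalIntegrable_L2 v ht)
    (intervalIntegrable_L2 _ ht), hsmul, intervalIntegral.integral_const_mul,
    integral_toL2 1 ht] at hsub
  change periodicLift _ hc hper (t : UnitAddCircle) =
    periodicLift _ hc hper ((0 : ℝ) : UnitAddCircle) +
      ∫ s in (0 : ℝ)..t, (v - meanL2 v • toL2 1) (s : UnitAddCircle)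
  rw [hsub, periodicLift_coe, periodicLift_coe]
  simp
  ring

theorem continuous_integral_L2 {t : ℝ} (ht : t ∈ Set.Icc (0 : ℝ) 1) :
    Continuous fun v : L2 => ∫ s in (0 : ℝ)..t, v (s : UnitAddCircle) := by
  let L : L2 →L[ℝ] ℝ := LinearMap.mkContinuous
    { toFun := fun v => ∫ s in (0 : ℝ)..t, v (s : UnitAddCircle)
      map_add' := fun v w => by
        rw [← intervalIntegral.integral_add (intervalIntegrable_L2 v ht)
          (intervalIntegrable_L2 w ht)]
        exact integral_L2_congr ht (ae_Ioc_of_ae (Lp.coeFn_add v w))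
      map_smul' := fun c v => by
        rw [RingHom.id_apply, smul_eq_mul, ← intervalIntegral.integral_const_mul]
        exact integral_L2_congr ht (ae_Ioc_of_ae (Lp.coeFn_smul c v)) } 1 fun v => by
    rw [one_mul]
    refine le_trans ?_ (integral_norm_le_norm_L2 v)
    rw [integral_circle_eq]
    change ‖∫ s in (0 : ℝ)..t, v (s : UnitAddCircle)‖ ≤ _
    refine (intervalIntegral.norm_integral_le_integral_norm ht.1).trans ?_
    exact intervalIntegral.integral_mono_interval le_rfl ht.1 ht.2
      (Eventually.of_forall fun _ => norm_nonneg _) (intervalIntegrable_L2 v one_mem_Icc).norm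
  exact L.continuous

theorem isClosed_H1 : IsClosed (H1 : Set (C0 × L2)) := by
  have h : (H1 : Set (C0 × L2)) = ⋂ t ∈ Set.Icc (0 : ℝ) 1, {p | p.1 (t : UnitAddCircle) =
      p.1 ((0 : ℝ) : UnitAddCircle) + ∫ s in (0 : ℝ)..t, p.2 (s : UnitAddCircle)} := by
    ext p
    simp only [Set.mem_iInter]
    rfl
  rw [h]
  refine isClosed_biInter fun t ht => isClosed_eq ?_ ?_
  · exact (continuous_eval_const _).comp continuous_fst
  · exact ((continuous_eval_const _).comp continuous_fst).add
      ((continuous_integral_L2 ht).comp continuous_snd)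

instance : CompleteSpace H1 := isClosed_H1.completeSpace_coe

/-- The pair `H¹`, `L²`. -/
def pairH : DerivPair H1 L2 where
  ι := LinearMap.mkContinuous
    { toFun := fun u => u.1.1
      map_add' := fun _ _ => rfl
      map_smul' := fun _ _ => rfl } 1 fun u => by
    rw [one_mul]; exact norm_fst_le u.1
  d := LinearMap.mkContinuous
    { toFun := fun u => u.1.2
      map_add' := fun _ _ => rfl
      map_smul' := fun _ _ => rfl } 1 fun u => by
    rw [one_mul]; exact norm_snd_le u.1
  e := toL2
  avg := meanL2
  one := ⟨(1, toL2 0), mem_H1_of_mem_C1 (p := (1, 0)) fun t => hasDerivAt_const t (1 : ℝ)⟩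
  prim := LinearMap.mkContinuous
    { toFun := fun x => ⟨(primL x, toL2 (x - mean x • 1)), mem_H1_of_mem_C1 (prim_mem_C1 x)⟩
      map_add' := fun x y => Subtype.ext (Prod.ext (map_add primL x y) (by
        change toL2 ((x + y) - mean (x + y) • (1 : C0)) =
          toL2 (x - mean x • 1) + toL2 (y - mean y • 1)
        rw [← map_add, map_add mean]
        congr 1
        module))
      map_smul' := fun c x => Subtype.ext (Prod.ext (map_smul primL c x) (by
        change toL2 ((c • x) - mean (c • x) • (1 : C0)) = c • toL2 (x - mean x • 1)
        rw [← map_smul, map_smul mean, smul_sub, smul_assoc])) }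
    (max ‖primL‖ ‖toL2.comp (ContinuousLinearMap.id ℝ C0 - mean.smulRight (1 : C0))‖)
    fun x => by
    refine max_le ?_ ?_
    · exact (primL.le_opNorm x).trans
        (mul_le_mul_of_nonneg_right (le_max_left _ _) (norm_nonneg _))
    · exact ((toL2.comp
        (ContinuousLinearMap.id ℝ C0 - mean.smulRight (1 : C0))).le_opNorm x).trans
        (mul_le_mul_of_nonneg_right (le_max_right _ _) (norm_nonneg _))
  eq_zero := fun _ h1 h2 => Subtype.ext (Prod.ext h1 h2)
  ι_one := rfl
  d_one := map_zero toL2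
  ι_prim := fun _ => rfl
  d_prim := fun _ => rfl
  avg_e := fun x => by
    rw [meanL2_eq, mean_eq]
    exact integral_toL2 x one_mem_Icc
  avg_d := fun u => meanL2_deriv u.2
  exists_d_eq := exists_primitive_L2
  exists_C1_of_d_eq := fun u x h =>
    ⟨(u.1.1, x), mem_C1_of_mem_H1 (by
      have h' : u.1.2 = toL2 x := h
      rw [← h']
      exact u.2), rfl, rfl⟩

end CircleODE

end

theorem proposition2p2 (f : UnitAddCircle → ℝ → ℝ) (hf : CircleODE.IsSmooth f) :
    -- the case `F : C¹ → C⁰`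
    ((∀ k : ℕ, 1 ≤ k → k ≤ 5 →
        CircleODE.stratumC f hf k =
          {u : CircleODE.C1 | ∀ i, 1 ≤ i → i ≤ k → CircleODE.Sig f i u.1.1 = 0}) ∧
      (∀ k : ℕ, 1 ≤ k → k ≤ 4 → ∀ u : CircleODE.C1,
        CircleODE.IsMorinSingularity (CircleODE.opC f hf) k u ↔
          (∀ i, 1 ≤ i → i ≤ k → CircleODE.Sig f i u.1.1 = 0) ∧
          CircleODE.Sig f (k + 1) u.1.1 ≠ 0 ∧
          Function.Surjective
            (fderiv ℝ (fun (v : CircleODE.C1) (i : Fin (k - 1)) =>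
              CircleODE.Sig f (i + 1) v.1.1) u))) ∧
    -- the case `F : H¹ → L²`
    ((∀ k : ℕ, 1 ≤ k → k ≤ 5 →
        CircleODE.stratumH f hf k =
          {u : CircleODE.H1 | ∀ i, 1 ≤ i → i ≤ k → CircleODE.Sig f i u.1.1 = 0}) ∧
      (∀ k : ℕ, 1 ≤ k → k ≤ 4 → ∀ u : CircleODE.H1,
        CircleODE.IsMorinSingularity (CircleODE.opH f hf) k u ↔
          (∀ i, 1 ≤ i → i ≤ k → CircleODE.Sig f i u.1.1 = 0) ∧
          CircleODE.Sig f (k + 1) u.1.1 ≠ 0 ∧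
          Function.Surjective
            (fderiv ℝ (fun (v : CircleODE.H1) (i : Fin (k - 1)) =>
              CircleODE.Sig f (i + 1) v.1.1) u))) :=
  -- The operators, averages and constants of the two pairs unfold to those of the statement.
  ⟨⟨fun k _ hk => CircleODE.pairC.stratum_eq f hf k hk,
      fun k h1 hk u => CircleODE.pairC.isMorinSingularity_iff f hf k h1 hk u⟩,
    ⟨fun k _ hk => CircleODE.pairH.stratum_eq f hf k hk,
      fun k h1 hk u => CircleODE.pairH.isMorinSingularity_iff f hf k h1 hk u⟩⟩
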